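/- Let $k$ be a (commutative) field, $\alpha:k\to k$ a field endomorphism (not necessarily surjective) and $\delta:k\to k$ an $\alpha$-derivation, i.e. an additive map with $\delta(ab)=\delta(a)\alpha(b)+a\,\delta(b)$. Let $R=k[x;\alpha,\delta]$ be the left skew polynomial ring: its elements are the expressions $a_0+a_1x+\dots+a_mx^m$ with $a_i\in k$, and its multiplication is determined by $xa=\alpha(a)x+\delta(a)$. Let $Q$ be its skew field of (left) fractions $s^{-1}r$ ($r,s\in R$, $s\neq0$), with the degree map $\deg:Q\to\mathbb Z\cup\{\infty\}$, $s^{-1}r\mapsto\deg r-\deg s$ for $r\ne0$ and $0\mapsto\infty$; it factors over $Q^{\rm ab}=Q^\times/[Q^\times,Q^\times]\cup\{0\}$. Let $n\ge1$, let $\det:M(n,Q)\to Q^{\rm ab}$ be the Dieudonné determinant, and let $\deg\det:M(n,Q)\to\mathbb Z\cup\{\infty\}$ be its composite with the degree map. Then: 1. The restriction of $\deg\det$ to the ring $M(n,R)$ of $n\times n$ matrices takes values in $\mathbb N\cup\{\infty\}$ and induces an exact sequence of unitary semigroups $$1\to GL(n,R)\to M(n,R)\xrightarrow{\ \deg\det\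 }\mathbb N\cup\{\infty\}\to 0,$$ where $M(n,R)$ is taken with multiplication and $\mathbb N\cup\{\infty\}$ with addition. That is, $\deg\det(1)=0$ and $\deg\det(AB)=\deg\det(A)+\deg\det(B)$ for all $A,B\in M(n,R)$; the set of $A\in M(n,R)$ with $\deg\det(A)=0$ is exactly $GL(n,R)$, the group of invertible elements of $M(n,R)$; and every element of $\mathbb N\cup\{\infty\}$ is $\deg\det(A)$ for some $A\in M(n,R)$. 2. If $f:M(n,R)\to\mathbb Z\cup\{\infty\}$ is a map with $f(AB)=f(A)+f(B)$ for all $A,B\in M(n,R)$ that agrees with $\deg\det$ on all diagonal matrices, then $f=\deg\det$ on $M(n,R)$. 3. For every $A\in M(n,R)$ one has $\deg\det(A)=\dim_k(R^n/R^nA)\in\mathbb N\cup\{\infty\}$, where $R^n$ is the left $R$-module of row vectors, $R^nA=\{vA: v\in R^n\}$, and the dimension is that of a left $k$-vector space. -/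

import Mathlib

open scoped nonZeroDivisors

universe u

/-- An `α`-derivation of the field `k`: an additive map `δ : k → k` with
`δ (a b) = δ a · α b + a · δ b`. -/
structure SkewDerivation {k : Type u} [Field k] (α : k →+* k) extends k →+ k where
  leibniz' : ∀ a b : k, toFun (a * b) = toFun a * α b + a * toFun b

namespace SkewDerivation

variable {k : Type u} [Field k] {α : k →+* k}

theorem leibniz (δ : SkewDerivation α) (a b : k) :
    δ.toAddMonoidHom (a * b) = δ.toAddMonoidHom a * α b + a * δ.toAddMonoidHom b :=
  δ.leibniz' a b

theorem map_one_eq_zero (δ : SkewDerivation α) : δ.toAddMonoidHom 1 = 0 := by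
  have h := δ.leibniz 1 1
  simpa using h

end SkewDerivation

/-- The elements of the left skew polynomial ring `k[x; α, δ]` are the expressions
`a₀ + a₁ x + ⋯ + aₘ xᵐ` with coefficients `aᵢ ∈ k` on the left. As a left `k`-vector space
this is `k[X]`; the multiplication is the twisted one defined below. -/
@[ext]
structure SkewPoly {k : Type u} [Field k] {α : k →+* k} (_δ : SkewDerivation α) : Type u where
  /-- The skew polynomial with given (left) coefficients. -/
  ofPoly ::
  /-- The (left) coefficients of a skew polynomial. -/
  toPoly : Polynomial k

namespace SkewPoly

variable {k : Type u} [Field k] {α : k →+* k} (δ : SkewDerivation α)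

theorem toPoly_injective : Function.Injective (toPoly : SkewPoly δ → Polynomial k) :=
  fun _ _ h => SkewPoly.ext h

noncomputable instance : Zero (SkewPoly δ) := ⟨⟨0⟩⟩

noncomputable instance : Add (SkewPoly δ) := ⟨fun f g => ⟨f.toPoly + g.toPoly⟩⟩

noncomputable instance : Neg (SkewPoly δ) := ⟨fun f => ⟨-f.toPoly⟩⟩

noncomputable instance : Sub (SkewPoly δ) := ⟨fun f g => ⟨f.toPoly - g.toPoly⟩⟩

noncomputable instance : SMul ℕ (SkewPoly δ) := ⟨fun m f => ⟨m • f.toPoly⟩⟩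

noncomputable instance : SMul ℤ (SkewPoly δ) := ⟨fun m f => ⟨m • f.toPoly⟩⟩

noncomputable instance : SMul k (SkewPoly δ) := ⟨fun a f => ⟨a • f.toPoly⟩⟩

noncomputable instance : AddCommGroup (SkewPoly δ) :=
  (toPoly_injective δ).addCommGroup toPoly rfl (fun _ _ => rfl) (fun _ => rfl) (fun _ _ => rfl)
    (fun _ _ => rfl) (fun _ _ => rfl)

/-- The identification of additive groups of `k[x; α, δ]` with `k[X]`. -/
noncomputable def toPolyHom : SkewPoly δ →+ Polynomial k where
  toFun := toPoly
  map_zero' := rfl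
  map_add' _ _ := rfl

noncomputable instance : Module k (SkewPoly δ) :=
  (toPoly_injective δ).module k (toPolyHom δ) (fun _ _ => rfl)

/-- Left multiplication by `x`: the additive map with
`x · (a xⁱ) = α a · xⁱ⁺¹ + δ a · xⁱ`. -/
noncomputable def xMul : Polynomial k →+ Polynomial k where
  toFun f := f.sum fun i a =>
    Polynomial.monomial (i + 1) (α a) + Polynomial.monomial i (δ.toAddMonoidHom a)
  map_zero' := by simp
  map_add' f g := by
    apply Polynomial.sum_add_index
    · intro i; simp
    · intro i a b; simp only [map_add]; abel

/-- The product in `k[x; α, δ]`: `(∑ᵢ aᵢ xⁱ) · g = ∑ᵢ aᵢ · (x · (x · ⋯ (x · g)))`, with `i` factors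
`x` in the `i`-th summand. -/
noncomputable def mulAux (f g : Polynomial k) : Polynomial k :=
  f.sum fun i a => a • (xMul δ)^[i] g

theorem xMul_monomial (i : ℕ) (a : k) : xMul δ (Polynomial.monomial i a) =
    Polynomial.monomial (i + 1) (α a) + Polynomial.monomial i (δ.toAddMonoidHom a) := by
  simp [xMul, Polynomial.sum_monomial_index]

theorem xMul_smul (a : k) (f : Polynomial k) :
    xMul δ (a • f) = α a • xMul δ f + δ.toAddMonoidHom a • f := by
  induction f using Polynomial.induction_on' with
  | add p q hp hq => simp only [smul_add, map_add, hp, hq]; abel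
  | monomial i b =>
    have hl := δ.leibniz b a
    rw [mul_comm b a] at hl
    simp only [Polynomial.smul_monomial, xMul_monomial, smul_add, smul_eq_mul, map_mul, hl,
      map_add, mul_comm b]
    rw [mul_comm (δ.toAddMonoidHom b)]
    abel

theorem mulAux_add_left (f g h : Polynomial k) :
    mulAux δ (f + g) h = mulAux δ f h + mulAux δ g h := by
  apply Polynomial.sum_add_index
  · intro i; simp
  · intro i a b; simp only [add_smul]

theorem mulAux_monomial (i : ℕ) (a : k) (g : Polynomial k) :
    mulAux δ (Polynomial.monomial i a) g = a • (xMul δ)^[i] g := by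
  simp [mulAux, Polynomial.sum_monomial_index]

theorem mulAux_add_right (f g h : Polynomial k) :
    mulAux δ f (g + h) = mulAux δ f g + mulAux δ f h := by
  induction f using Polynomial.induction_on' with
  | add p q hp hq => simp only [mulAux_add_left, hp, hq]; abel
  | monomial i b => simp only [mulAux_monomial, iterate_map_add, smul_add]

theorem mulAux_smul (a : k) (f g : Polynomial k) : mulAux δ (a • f) g = a • mulAux δ f g := by
  induction f using Polynomial.induction_on' with
  | add p q hp hq => simp only [smul_add, mulAux_add_left, hp, hq]
  | monomial i b => simp only [Polynomial.smul_monomial, mulAux_monomial, smul_eq_mul, mul_smul]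

theorem mulAux_xMul (f g : Polynomial k) :
    mulAux δ (xMul δ f) g = xMul δ (mulAux δ f g) := by
  induction f using Polynomial.induction_on' with
  | add p q hp hq => simp only [map_add, mulAux_add_left, hp, hq]
  | monomial i b =>
    simp only [xMul_monomial, mulAux_add_left, mulAux_monomial, xMul_smul,
      Function.iterate_succ_apply']

theorem mulAux_assoc (f g h : Polynomial k) :
    mulAux δ (mulAux δ f g) h = mulAux δ f (mulAux δ g h) := by
  induction f using Polynomial.induction_on' with
  | add p q hp hq => simp only [mulAux_add_left, hp, hq]
  | monomial i b =>
    simp only [mulAux_monomial, mulAux_smul]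
    congr 1
    induction i with
    | zero => rfl
    | succ i ih => simp only [Function.iterate_succ_apply', mulAux_xMul, ih]

theorem iterate_xMul_one (i : ℕ) : (xMul δ)^[i] 1 = Polynomial.monomial i (1 : k) := by
  induction i with
  | zero => rfl
  | succ i ih =>
    rw [Function.iterate_succ_apply', ih, xMul_monomial, map_one, δ.map_one_eq_zero]
    simp

theorem mulAux_one (f : Polynomial k) : mulAux δ f 1 = f := by
  induction f using Polynomial.induction_on' with
  | add p q hp hq => simp only [mulAux_add_left, hp, hq]
  | monomial i b => simp [mulAux_monomial, iterate_xMul_one, Polynomial.smul_monomial]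

theorem one_mulAux (f : Polynomial k) : mulAux δ 1 f = f := by
  have := mulAux_monomial δ 0 1 f
  simpa using this

noncomputable instance : Mul (SkewPoly δ) := ⟨fun f g => ⟨mulAux δ f.toPoly g.toPoly⟩⟩

noncomputable instance : One (SkewPoly δ) := ⟨⟨1⟩⟩

theorem mulAux_zero (f : Polynomial k) : mulAux δ f 0 = 0 := by
  have h := mulAux_add_right δ f 0 0
  simpa using h

theorem zero_mulAux (f : Polynomial k) : mulAux δ 0 f = 0 := by
  simp [mulAux]

/-- The skew polynomial ring `k[x; α, δ]`. -/
noncomputable instance : Ring (SkewPoly δ) where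
  __ := (inferInstance : AddCommGroup (SkewPoly δ))
  left_distrib f g h := SkewPoly.ext (mulAux_add_right δ f.toPoly g.toPoly h.toPoly)
  right_distrib f g h := SkewPoly.ext (mulAux_add_left δ f.toPoly g.toPoly h.toPoly)
  zero_mul f := SkewPoly.ext (zero_mulAux δ f.toPoly)
  mul_zero f := SkewPoly.ext (mulAux_zero δ f.toPoly)
  mul_assoc f g h := SkewPoly.ext (mulAux_assoc δ f.toPoly g.toPoly h.toPoly)
  one_mul f := SkewPoly.ext (one_mulAux δ f.toPoly)
  mul_one f := SkewPoly.ext (mulAux_one δ f.toPoly)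

theorem toPoly_zero : (0 : SkewPoly δ).toPoly = 0 := rfl

theorem toPoly_one : (1 : SkewPoly δ).toPoly = 1 := rfl

theorem toPoly_add (f g : SkewPoly δ) : (f + g).toPoly = f.toPoly + g.toPoly := rfl

theorem toPoly_sub (f g : SkewPoly δ) : (f - g).toPoly = f.toPoly - g.toPoly := rfl

theorem toPoly_smul (a : k) (f : SkewPoly δ) : (a • f).toPoly = a • f.toPoly := rfl

theorem toPoly_mul (f g : SkewPoly δ) : (f * g).toPoly = mulAux δ f.toPoly g.toPoly := rfl

theorem toPoly_eq_zero {f : SkewPoly δ} : f.toPoly = 0 ↔ f = 0 :=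
  (toPoly_injective δ).eq_iff' rfl

instance : Nontrivial (SkewPoly δ) :=
  ⟨0, 1, fun h => zero_ne_one (α := Polynomial k) (congrArg toPoly h)⟩

/-- The constant `a ∈ k`, as an element of `k[x; α, δ]`. -/
noncomputable def C (a : k) : SkewPoly δ := ⟨Polynomial.C a⟩

/-- The variable `x` of `k[x; α, δ]`. -/
noncomputable def X : SkewPoly δ := ⟨Polynomial.X⟩

/-- The commutation rule `x a = α a · x + δ a`. -/
theorem X_mul_C (a : k) : X δ * C δ a = C δ (α a) * X δ + C δ (δ.toAddMonoidHom a) := by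
  apply toPoly_injective
  simp only [toPoly_mul, toPoly_add, X, C]
  have h := xMul_monomial δ 0 a
  have h₁ := mulAux_monomial δ 1 1 (Polynomial.C a)
  have h₂ := mulAux_monomial δ 0 (α a) Polynomial.X
  simp only [Polynomial.monomial_zero_left, zero_add, Function.iterate_one, one_smul,
    Polynomial.monomial_one_one_eq_X, Function.iterate_zero, id] at h h₁ h₂
  rw [h₁, h₂, h, ← Polynomial.monomial_one_one_eq_X, Polynomial.smul_monomial]
  simp

instance : IsScalarTower k (SkewPoly δ) (SkewPoly δ) :=
  ⟨fun a f g => SkewPoly.ext (mulAux_smul δ a f.toPoly g.toPoly)⟩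

/-! ### The degree -/

/-- The degree of a skew polynomial (with value `0` at `0`). -/
noncomputable def natDegree (f : SkewPoly δ) : ℕ := f.toPoly.natDegree

theorem degree_xMul (f : Polynomial k) : (xMul δ f).degree = f.degree + 1 := by
  have hc : ∀ j, (xMul δ f).coeff (j + 1) = α (f.coeff j) + δ.toAddMonoidHom (f.coeff (j + 1)) := by
    intro j
    induction f using Polynomial.induction_on' with
    | add p q hp hq => simp only [map_add, Polynomial.coeff_add, hp, hq]; abel
    | monomial i b =>
      simp only [xMul_monomial, Polynomial.coeff_add, Polynomial.coeff_monomial,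
        add_left_inj]
      split_ifs <;> simp
  by_cases hf : f = 0
  · simp [hf]
  have hd : f.degree + 1 = ((f.natDegree + 1 : ℕ) : WithBot ℕ) := by
    rw [Polynomial.degree_eq_natDegree hf]; rfl
  rw [hd]
  refine Polynomial.degree_eq_of_le_of_coeff_ne_zero ?_ ?_
  · rw [Polynomial.degree_le_iff_coeff_zero]
    intro m hm
    have hm' : f.natDegree + 1 < m := by exact_mod_cast hm
    obtain ⟨j, rfl⟩ : ∃ j, m = j + 1 := ⟨m - 1, by omega⟩
    rw [hc, Polynomial.coeff_eq_zero_of_natDegree_lt (by omega),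
      Polynomial.coeff_eq_zero_of_natDegree_lt (by omega)]
    simp
  · rw [hc, Polynomial.coeff_eq_zero_of_natDegree_lt (n := f.natDegree + 1) (by omega)]
    simpa using hf

theorem degree_iterate_xMul (i : ℕ) (f : Polynomial k) :
    ((xMul δ)^[i] f).degree = f.degree + i := by
  induction i with
  | zero => simp
  | succ i ih => rw [Function.iterate_succ_apply', degree_xMul, ih]; push_cast; rw [add_assoc]

theorem degree_mulAux (f g : Polynomial k) : (mulAux δ f g).degree = f.degree + g.degree := by
  induction hn : f.natDegree using Nat.strong_induction_on generalizing f with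
  | _ n ih =>
  by_cases hf : f = 0
  · simp [hf, mulAux]
  by_cases hg : g = 0
  · have h := mulAux_add_right δ f 0 0
    rw [hg]
    simp only [add_zero, right_eq_add] at h
    simp [h]
  have hlead : (mulAux δ (Polynomial.monomial f.natDegree f.leadingCoeff) g).degree =
      f.degree + g.degree := by
    rw [mulAux_monomial, Polynomial.degree_smul_of_smul_regular _
      (IsSMulRegular.of_ne_zero (by simpa using hf)), degree_iterate_xMul,
      Polynomial.degree_eq_natDegree hf, add_comm]
  have hsplit := f.eraseLead_add_monomial_natDegree_leadingCoeff
  conv_lhs => rw [← hsplit, mulAux_add_left]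
  rw [Polynomial.degree_add_eq_right_of_degree_lt, hlead]
  rw [hlead]
  by_cases he : f.eraseLead = 0
  · rw [he]
    simp only [mulAux, Polynomial.sum_zero_index, Polynomial.degree_zero]
    rw [Polynomial.degree_eq_natDegree hf, Polynomial.degree_eq_natDegree hg]
    exact WithBot.bot_lt_coe _
  · have hlt : f.eraseLead.degree < f.degree := Polynomial.degree_eraseLead_lt hf
    rw [ih _ (by rw [← hn]; exact Polynomial.natDegree_lt_natDegree he hlt) _ rfl,
      Polynomial.degree_eq_natDegree hg]
    exact WithBot.add_lt_add_right (WithBot.coe_ne_bot) hlt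

instance : NoZeroDivisors (SkewPoly δ) where
  eq_zero_or_eq_zero_of_mul_eq_zero {f g} h := by
    rw [← toPoly_eq_zero, toPoly_mul, ← Polynomial.degree_eq_bot, degree_mulAux,
      WithBot.add_eq_bot, Polynomial.degree_eq_bot, Polynomial.degree_eq_bot] at h
    simpa only [toPoly_eq_zero] using h

theorem natDegree_mul {f g : SkewPoly δ} (hf : f ≠ 0) (hg : g ≠ 0) :
    natDegree δ (f * g) = natDegree δ f + natDegree δ g := by
  have h := degree_mulAux δ f.toPoly g.toPoly
  have hfg : f * g ≠ 0 := mul_ne_zero hf hg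
  rw [← toPoly_mul, Polynomial.degree_eq_natDegree (mt (toPoly_eq_zero δ).1 hfg),
    Polynomial.degree_eq_natDegree (mt (toPoly_eq_zero δ).1 hf),
    Polynomial.degree_eq_natDegree (mt (toPoly_eq_zero δ).1 hg)] at h
  exact_mod_cast h

/-! ### The Ore condition, through division with remainder -/

theorem exists_divAux (s : Polynomial k) (hs : s ≠ 0) (r : Polynomial k) :
    ∃ q t : Polynomial k, r = mulAux δ q s + t ∧ t.degree < s.degree := by
  induction hn : r.natDegree using Nat.strong_induction_on generalizing r with
  | _ n ih =>
  have hs' : (0 : Polynomial k).degree < s.degree := by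
    rw [Polynomial.degree_zero, bot_lt_iff_ne_bot]
    exact fun h => hs (Polynomial.degree_eq_bot.1 h)
  by_cases hlt : r.degree < s.degree
  · exact ⟨0, r, by simp [mulAux], hlt⟩
  have hr : r ≠ 0 := by
    rintro rfl
    exact hlt hs'
  have hle : s.natDegree ≤ r.natDegree := Polynomial.natDegree_le_natDegree (not_lt.1 hlt)
  obtain ⟨p, hp⟩ : ∃ p, p = (xMul δ)^[r.natDegree - s.natDegree] s := ⟨_, rfl⟩
  have hpd : p.degree = r.degree := by
    rw [hp, degree_iterate_xMul, Polynomial.degree_eq_natDegree hs,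
      Polynomial.degree_eq_natDegree hr]
    norm_cast
    omega
  have hp0 : p ≠ 0 := by
    intro h
    rw [h, Polynomial.degree_zero] at hpd
    exact hr (Polynomial.degree_eq_bot.1 hpd.symm)
  obtain ⟨c, hc⟩ : ∃ c, c = r.leadingCoeff / p.leadingCoeff := ⟨_, rfl⟩
  have hc0 : c ≠ 0 := by
    rw [hc]
    exact div_ne_zero (by simpa using hr) (by simpa using hp0)
  have hcpd : (c • p).degree = r.degree := by
    rw [Polynomial.degree_smul_of_smul_regular _ (IsSMulRegular.of_ne_zero hc0), hpd]
  have hlc : r.leadingCoeff = (c • p).leadingCoeff := by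
    rw [Polynomial.smul_eq_C_mul, Polynomial.leadingCoeff_mul, Polynomial.leadingCoeff_C, hc]
    exact (div_mul_cancel₀ _ (by simpa using hp0)).symm
  have hdlt : (r - c • p).degree < r.degree := Polynomial.degree_sub_lt_left hcpd.symm hr hlc
  have hmul : mulAux δ (Polynomial.monomial (r.natDegree - s.natDegree) c) s = c • p := by
    rw [mulAux_monomial, hp]
  by_cases h0 : r - c • p = 0
  · refine ⟨Polynomial.monomial (r.natDegree - s.natDegree) c, 0, ?_, hs'⟩
    rw [hmul, add_zero, sub_eq_zero.1 h0]
  · obtain ⟨q, t, h, ht⟩ := ih _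
      (by rw [← hn]; exact Polynomial.natDegree_lt_natDegree h0 hdlt) (r - c • p) rfl
    refine ⟨Polynomial.monomial (r.natDegree - s.natDegree) c + q, t, ?_, ht⟩
    rw [mulAux_add_left, add_assoc, ← h, hmul]
    abel

theorem exists_div (s : SkewPoly δ) (hs : s ≠ 0) (r : SkewPoly δ) :
    ∃ q t : SkewPoly δ, r = q * s + t ∧ t.toPoly.degree < s.toPoly.degree := by
  obtain ⟨q, t, h, ht⟩ := exists_divAux δ s.toPoly (mt (toPoly_eq_zero δ).1 hs) r.toPoly
  exact ⟨⟨q⟩, ⟨t⟩, SkewPoly.ext h, ht⟩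

theorem exists_ore (r s : SkewPoly δ) (hs : s ≠ 0) :
    ∃ u v : SkewPoly δ, u ≠ 0 ∧ u * r = v * s := by
  induction hd : s.toPoly.natDegree using Nat.strong_induction_on
    generalizing r s with
  | _ n ih =>
  obtain ⟨q, t, h, ht⟩ := exists_div δ s hs r
  by_cases h0 : t = 0
  · exact ⟨1, q, one_ne_zero, by rw [h, h0]; simp⟩
  · obtain ⟨u, v, hu, huv⟩ := ih _
      (by rw [← hd]; exact Polynomial.natDegree_lt_natDegree (mt (toPoly_eq_zero δ).1 h0) ht) s t h0 rfl
    refine ⟨v, v * q + u, ?_, ?_⟩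
    · rintro rfl
      rw [zero_mul] at huv
      exact (mul_ne_zero hu hs) huv
    · rw [h, mul_add, add_mul, huv, mul_assoc]

noncomputable instance : OreLocalization.OreSet (SkewPoly δ)⁰ :=
  Classical.choice <| OreLocalization.nonempty_oreSet_iff_of_noZeroDivisors.2 fun r s => by
    obtain ⟨u, v, hu, h⟩ := exists_ore δ r s (nonZeroDivisors.coe_ne_zero s)
    exact ⟨v, ⟨u, mem_nonZeroDivisors_of_ne_zero hu⟩, h⟩

/-- The skew field of fractions `Q` of `R = k[x; α, δ]`, consisting of the left fractions
`s⁻¹ r`, with `r, s ∈ R` and `s ≠ 0`. -/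
abbrev Frac : Type u := OreLocalization (SkewPoly δ)⁰ (SkewPoly δ)

/-- The embedding of `R = k[x; α, δ]` in its skew field of fractions. -/
noncomputable def toFrac : SkewPoly δ →+* Frac δ := OreLocalization.numeratorRingHom

open Classical in
/-- The degree map `Q → ℤ ∪ {∞}`, `s⁻¹ r ↦ deg r - deg s`, with `0 ↦ ∞`. -/
noncomputable def degFrac : Frac δ → WithTop ℤ :=
  OreLocalization.liftExpand
    (fun (r : SkewPoly δ) (s : (SkewPoly δ)⁰) =>
      if r = 0 then (⊤ : WithTop ℤ)
      else (((natDegree δ r : ℤ) - (natDegree δ (s : SkewPoly δ) : ℤ) : ℤ) : WithTop ℤ))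
    (by
      intro r t s ht
      have hts : t * (s : SkewPoly δ) ≠ 0 := nonZeroDivisors.ne_zero ht
      have ht0 : t ≠ 0 := left_ne_zero_of_mul hts
      have hs0 : (s : SkewPoly δ) ≠ 0 := right_ne_zero_of_mul hts
      by_cases hr : r = 0
      · simp [hr]
      · simp only [smul_eq_mul, mul_eq_zero, ht0, hr, or_self, if_false,
          natDegree_mul δ ht0 hr, natDegree_mul δ ht0 hs0]
        congr 1
        push_cast
        ring)

open OreLocalization in
open Classical in
theorem degFrac_oreDiv (r : SkewPoly δ) (s : (SkewPoly δ)⁰) :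
    degFrac δ (r /ₒ s) = if r = 0 then (⊤ : WithTop ℤ)
      else (((natDegree δ r : ℤ) - (natDegree δ (s : SkewPoly δ) : ℤ) : ℤ) : WithTop ℤ) :=
  rfl

open OreLocalization in
theorem degFrac_mul (a b : Frac δ) : degFrac δ (a * b) = degFrac δ a + degFrac δ b := by
  induction a using OreLocalization.ind with | _ r₁ s₁
  induction b using OreLocalization.ind with | _ r₂ s₂
  have h := OreLocalization.ore_eq r₁ s₂
  have hd : (oreDenom r₁ s₂ : SkewPoly δ) ≠ 0 := nonZeroDivisors.coe_ne_zero _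
  have hs₁ : (s₁ : SkewPoly δ) ≠ 0 := nonZeroDivisors.coe_ne_zero _
  have hs₂ : (s₂ : SkewPoly δ) ≠ 0 := nonZeroDivisors.coe_ne_zero _
  rw [oreDiv_mul_oreDiv]
  simp only [degFrac_oreDiv]
  by_cases h₁ : r₁ = 0
  · have h0 : oreNum r₁ s₂ = 0 := by
      rw [h₁, mul_zero] at h
      rw [h₁]
      exact (mul_eq_zero.1 h.symm).resolve_right hs₂
    rw [if_pos h₁, if_pos (by rw [h0, zero_mul]), top_add]
  by_cases h₂ : r₂ = 0
  · simp [h₂]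
  have hn : oreNum r₁ s₂ ≠ 0 := by
    intro h0
    rw [h0, zero_mul] at h
    exact mul_ne_zero hd h₁ h
  have e := congrArg (natDegree δ) h
  rw [natDegree_mul δ hd h₁, natDegree_mul δ hn hs₂] at e
  simp only [h₁, h₂, mul_eq_zero, hn, or_self, if_false, Submonoid.coe_mul,
    natDegree_mul δ hn h₂, natDegree_mul δ hd hs₁, ← WithTop.coe_add]
  congr 1
  push_cast
  omega

theorem degFrac_one : degFrac δ 1 = 0 := by
  rw [OreLocalization.one_def, degFrac_oreDiv]
  simp

theorem degFrac_ne_top (a : Frac δ) (ha : a ≠ 0) : degFrac δ a ≠ ⊤ := by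
  induction a using OreLocalization.ind with | _ r s
  have hr : r ≠ 0 := by rintro rfl; simp at ha
  simp [degFrac_oreDiv, hr]

/-- The degree as a group homomorphism `Qˣ → ℤ`. -/
noncomputable def degUnits : (Frac δ)ˣ →* Multiplicative ℤ where
  toFun a := Multiplicative.ofAdd ((degFrac δ a).untop (degFrac_ne_top δ a a.ne_zero))
  map_one' := by
    apply Multiplicative.toAdd.injective
    apply WithTop.coe_injective
    simp [degFrac_one]
  map_mul' a b := by
    apply Multiplicative.toAdd.injective
    apply WithTop.coe_injective
    simp [degFrac_mul]

end SkewPoly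

/-! ### The Dieudonné determinant -/

section Dieudonne

/-- The monoid `Dᵃᵇ = Dˣ / [Dˣ, Dˣ] ∪ {0}` attached to a skew field `D`. -/
abbrev DivAb (D : Type u) [DivisionRing D] : Type u := WithZero (Abelianization Dˣ)

open Classical in
/-- The canonical map `D → Dᵃᵇ`. -/
noncomputable def divAbClass {D : Type u} [DivisionRing D] (a : D) : DivAb D :=
  if h : a = 0 then 0 else ((Abelianization.of (Units.mk0 a h) : Abelianization Dˣ) : DivAb D)

open Classical in
/-- The Dieudonné determinant `det : M(n, D) → Dᵃᵇ` of matrices over a skew field `D`, computed by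
elimination with left row operations: the determinant of the empty matrix is `1`; if the
first column of `A` vanishes then `det A = 0`; otherwise, with `A i 0 ≠ 0` the first nonzero entry
of the first column, row `i` is moved to the top by `i` interchanges (each contributing the class
of `-1`), left multiples of it are subtracted from the other rows to clear the first column,
and `det A` is the class of `A i 0` times the determinant of the remaining block. -/
noncomputable def dieudonneDet {D : Type u} [DivisionRing D] :
    {n : ℕ} → Matrix (Fin n) (Fin n) D → DivAb D
  | 0, _ => 1
  | _ + 1, A =>
    if h : ∃ i, A i 0 ≠ 0 then
      let i := Fin.find (fun i => A i 0 ≠ 0) h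
      divAbClass (-1 : D) ^ (i : ℕ) * divAbClass (A i 0) *
        dieudonneDet (Matrix.of fun j l =>
          A (i.succAbove j) l.succ - A (i.succAbove j) 0 * (A i 0)⁻¹ * A i l.succ)
    else 0

end Dieudonne

namespace SkewPoly

variable {k : Type u} [Field k] {α : k →+* k} (δ : SkewDerivation α)

/-- The map `deg : Qᵃᵇ → ℤ ∪ {∞}` through which the degree `Q → ℤ ∪ {∞}` factors. -/
noncomputable def degAb : DivAb (Frac δ) → WithTop ℤ :=
  WithZero.recZeroCoe ⊤ fun a =>
    ((Multiplicative.toAdd (Abelianization.lift (degUnits δ) a) : ℤ) : WithTop ℤ)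

theorem degAb_divAbClass (a : Frac δ) : degAb δ (divAbClass a) = degFrac δ a := by
  by_cases h : a = 0
  · subst h
    rw [divAbClass, dif_pos rfl, ← OreLocalization.zero_oreDiv 1, degFrac_oreDiv]
    simp [degAb]
  · rw [divAbClass, dif_neg h]
    simp [degAb, degUnits]

/-- The map `deg det : M(n, Q) → ℤ ∪ {∞}`. -/
noncomputable def degDetFrac {n : ℕ} (A : Matrix (Fin n) (Fin n) (Frac δ)) : WithTop ℤ :=
  degAb δ (dieudonneDet A)

/-- The restriction of `deg det` to `M(n, R)`. -/
noncomputable def degDet {n : ℕ} (A : Matrix (Fin n) (Fin n) (SkewPoly δ)) : WithTop ℤ :=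
  degDetFrac δ (A.map (toFrac δ))

/-- The left `R`-submodule `Rⁿ A` of the module `Rⁿ` of row vectors. -/
noncomputable def rowModule {n : ℕ} (A : Matrix (Fin n) (Fin n) (SkewPoly δ)) :
    Submodule (SkewPoly δ) (Fin n → SkewPoly δ) :=
  LinearMap.range A.vecMulLinear

/-- The dimension `dim_k (Rⁿ / Rⁿ A) ∈ ℕ ∪ {∞}`. -/
noncomputable def cokerDim {n : ℕ} (A : Matrix (Fin n) (Fin n) (SkewPoly δ)) : ℕ∞ :=
  Cardinal.toENat (Module.rank k ((Fin n → SkewPoly δ) ⧸ rowModule δ A))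

/-- The inclusion `ℕ ∪ {∞} → ℤ ∪ {∞}`. -/
def natToIntTop (m : ℕ∞) : WithTop ℤ := WithTop.map (fun j : ℕ => (j : ℤ)) m

end SkewPoly

/-! Write `c(A) = dim_k (Rⁿ/RⁿA)`. The theorem follows from showing that `c` is a monoid
homomorphism and that it agrees with `deg det`.

Multiplicativity (`cokerDim_mul`) comes from `0 → Rⁿ/RⁿA → Rⁿ/RⁿAB → Rⁿ/RⁿB → 0`, which is exact
once right multiplication by `B` is injective. This holds when `c(B)` is finite: `R` is
infinite-dimensional over `k`, so `RⁿB` contains a nonzero multiple of each basis vector and `B`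
becomes invertible over `Q`. If `c(B) = ∞`, the surjection onto `Rⁿ/RⁿB` makes both sides infinite.
Moreover `c(A) = 0` says that `A` has a left inverse, hence is a unit, since `R` embeds in a skew
field. On diagonal matrices `c` is the sum of the degrees, by division with remainder.

A homomorphism to `ℤ ∪ {∞}` that is finite on nonsingular diagonal matrices vanishes on
transvections (`map_transvection_eq_zero`): diagonal matrices rescale the parameter `a ≠ 0` of a
transvection, so its value does not depend on `a`, and additivity in the parameter makes that value
equal to its double. The Euclidean algorithm generates `M(n, R)` from diagonal matrices and
transvections (`elementaryDiagonal_eq_top`), whence uniqueness.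

To reach `deg det`, which is defined by elimination over `Q`, `c` is extended to `M(n, Q)` by
clearing denominators (`latticeIndex`). The extension is again multiplicative with the degree sum on
diagonals. Such a family kills transvections and permutation matrices, so it obeys the elimination
recursion and equals `deg det` (`degDetFrac_eq`). -/

section Generation

/-! ### Generation of matrices by diagonal matrices and transvections -/

variable {S : Type*} [Ring S]

/-- The submonoid of `M(n, S)` generated by the transvections. -/
def elementaryMatrices (S : Type*) [Ring S] (n : ℕ) : Submonoid (Matrix (Fin n) (Fin n) S) :=
  Submonoid.closure {A | ∃ i j, i ≠ j ∧ ∃ c, A = 1 + Matrix.single i j c}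

/-- The submonoid of `M(n, S)` generated by the diagonal matrices and the transvections. -/
def elementaryDiagonal (S : Type*) [Ring S] (n : ℕ) : Submonoid (Matrix (Fin n) (Fin n) S) :=
  Submonoid.closure (Set.range Matrix.diagonal ∪
    {A | ∃ i j, i ≠ j ∧ ∃ c, A = 1 + Matrix.single i j c})

theorem elementaryMatrices_le (n : ℕ) : elementaryMatrices S n ≤ elementaryDiagonal S n :=
  Submonoid.closure_mono Set.subset_union_right

theorem diagonal_mem_elementaryDiagonal {n : ℕ} (d : Fin n → S) :
    Matrix.diagonal d ∈ elementaryDiagonal S n :=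
  Submonoid.subset_closure (Or.inl ⟨d, rfl⟩)

theorem transvection_mem_elementaryMatrices {n : ℕ} {i j : Fin n} (h : i ≠ j) (c : S) :
    1 + Matrix.single i j c ∈ elementaryMatrices S n :=
  Submonoid.subset_closure ⟨i, j, h, c, rfl⟩

/-- The matrix of the row operation adding `q j` times row `i` to row `j`, for all `j ≠ i`. -/
def columnUnipotent {n : ℕ} (i : Fin n) (q : Fin n → S) : Matrix (Fin n) (Fin n) S :=
  1 + ∑ j ∈ Finset.univ.erase i, Matrix.single j i (q j)

theorem columnUnipotent_mul_apply {n : ℕ} (i : Fin n) (q : Fin n → S)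
    (A : Matrix (Fin n) (Fin n) S) (j l : Fin n) :
    (columnUnipotent i q * A) j l = if j = i then A j l else A j l + q j * A i l := by
  rw [columnUnipotent, add_mul, one_mul, Finset.sum_mul, Matrix.add_apply, Matrix.sum_apply]
  split_ifs with h
  · rw [Finset.sum_eq_zero, add_zero]
    intro x hx
    rw [Matrix.single_mul_apply_of_ne]
    rintro rfl
    simp [h] at hx
  · rw [Finset.sum_eq_single j, Matrix.single_mul_apply_same]
    · intro x _ hx
      rw [Matrix.single_mul_apply_of_ne]
      exact fun h => hx h.symm
    · simp [h]

theorem columnUnipotent_neg_mul {n : ℕ} (i : Fin n) (q : Fin n → S) :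
    columnUnipotent i (fun j => - q j) * columnUnipotent i q = 1 := by
  have h := columnUnipotent_mul_apply i q 1
  ext j l
  rw [columnUnipotent_mul_apply]
  rw [mul_one] at h
  simp only [h]
  by_cases hj : j = i <;> simp [hj]

theorem columnUnipotent_mem_elementaryMatrices {n : ℕ} (i : Fin n) (q : Fin n → S) :
    columnUnipotent i q ∈ elementaryMatrices S n := by
  unfold columnUnipotent
  -- The transvections can be multiplied one row at a time: for `a, x ≠ i` the cross terms `e_{ai}
  -- e_{xi}` vanish.
  suffices H : ∀ s : Finset (Fin n), i ∉ s →
      1 + ∑ j ∈ s, Matrix.single j i (q j) ∈ elementaryMatrices S n from H _ (by simp)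
  intro s
  induction s using Finset.induction_on with
  | empty => intro _; simp
  | insert a s ha ih =>
    intro hi
    rw [Finset.mem_insert, not_or] at hi
    have := mul_mem (transvection_mem_elementaryMatrices (Ne.symm hi.1) (q a)) (ih hi.2)
    convert this using 1
    rw [Finset.sum_insert ha, add_mul, one_mul, mul_add, mul_one, Finset.mul_sum,
      Finset.sum_eq_zero (s := s) (f := fun x => Matrix.single a i (q a) * Matrix.single x i (q x)),
      add_zero]
    · abel
    · intro x hx
      rw [Matrix.single_mul_single_of_ne]
      rintro rfl
      exact hi.2 hx

theorem columnUnipotent_mem {n : ℕ} (i : Fin n) (q : Fin n → S) :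
    columnUnipotent i q ∈ elementaryDiagonal S n :=
  elementaryMatrices_le _ (columnUnipotent_mem_elementaryMatrices i q)

/-- The block matrix with blocks `1` and `B` on the diagonal. -/
def extendOne {n : ℕ} (B : Matrix (Fin n) (Fin n) S) : Matrix (Fin (n + 1)) (Fin (n + 1)) S :=
  Matrix.of (Fin.cons (Fin.cons 1 0) fun i => Fin.cons 0 (B i))

@[simp] theorem extendOne_zero_zero {n : ℕ} (B : Matrix (Fin n) (Fin n) S) :
    extendOne B 0 0 = 1 := rfl

@[simp] theorem extendOne_zero_succ {n : ℕ} (B : Matrix (Fin n) (Fin n) S) (j : Fin n) :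
    extendOne B 0 j.succ = 0 := rfl

@[simp] theorem extendOne_succ_zero {n : ℕ} (B : Matrix (Fin n) (Fin n) S) (i : Fin n) :
    extendOne B i.succ 0 = 0 := rfl

@[simp] theorem extendOne_succ_succ {n : ℕ} (B : Matrix (Fin n) (Fin n) S) (i j : Fin n) :
    extendOne B i.succ j.succ = B i j := rfl

theorem extendOne_one {n : ℕ} : extendOne (1 : Matrix (Fin n) (Fin n) S) = 1 := by
  ext i j
  refine Fin.cases ?_ (fun i => ?_) i <;> refine Fin.cases ?_ (fun j => ?_) j <;>
    simp [Matrix.one_apply, Fin.succ_ne_zero, (Fin.succ_ne_zero _).symm]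

theorem extendOne_mul {n : ℕ} (A B : Matrix (Fin n) (Fin n) S) :
    extendOne (A * B) = extendOne A * extendOne B := by
  ext i j
  refine Fin.cases ?_ (fun i => ?_) i <;> refine Fin.cases ?_ (fun j => ?_) j <;>
    simp [Matrix.mul_apply, Fin.sum_univ_succ]

theorem extendOne_diagonal {n : ℕ} (d : Fin n → S) :
    extendOne (Matrix.diagonal d) = Matrix.diagonal (Fin.cons 1 d) := by
  ext i j
  refine Fin.cases ?_ (fun i => ?_) i <;> refine Fin.cases ?_ (fun j => ?_) j <;>
    simp [Matrix.diagonal_apply, Fin.succ_ne_zero, (Fin.succ_ne_zero _).symm]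

theorem extendOne_transvection {n : ℕ} (i j : Fin n) (c : S) :
    extendOne (1 + Matrix.single i j c) = 1 + Matrix.single i.succ j.succ c := by
  ext a b
  refine Fin.cases ?_ (fun a => ?_) a <;> refine Fin.cases ?_ (fun b => ?_) b <;>
    simp [Matrix.one_apply, Matrix.single_apply, Fin.succ_ne_zero, (Fin.succ_ne_zero _).symm]

theorem extendOne_mem {n : ℕ} {B : Matrix (Fin n) (Fin n) S} (hB : B ∈ elementaryDiagonal S n) :
    extendOne B ∈ elementaryDiagonal S (n + 1) := by
  induction hB using Submonoid.closure_induction with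
  | mem B hB =>
    rcases hB with ⟨d, rfl⟩ | ⟨i, j, hij, c, rfl⟩
    · rw [extendOne_diagonal]
      exact diagonal_mem_elementaryDiagonal _
    · rw [extendOne_transvection]
      exact elementaryMatrices_le _ (transvection_mem_elementaryMatrices (by simpa using hij) c)
  | one => rw [extendOne_one]; exact one_mem _
  | mul A B _ _ hA hB => rw [extendOne_mul]; exact mul_mem hA hB

/-- The matrix which agrees with the identity except that its first row is `1, b`. -/
def rowUnipotent {n : ℕ} (b : Fin n → S) : Matrix (Fin (n + 1)) (Fin (n + 1)) S :=
  1 + ∑ j, Matrix.single 0 j.succ (b j)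

theorem rowUnipotent_mem_elementaryMatrices {n : ℕ} (b : Fin n → S) :
    rowUnipotent b ∈ elementaryMatrices S (n + 1) := by
  unfold rowUnipotent
  suffices H : ∀ s : Finset (Fin n),
      1 + ∑ j ∈ s, Matrix.single 0 j.succ (b j) ∈ elementaryMatrices S (n + 1) from H _
  intro s
  induction s using Finset.induction_on with
  | empty => simp
  | insert a s ha ih =>
    have := mul_mem (transvection_mem_elementaryMatrices (Fin.succ_ne_zero a).symm (b a)) ih
    convert this using 1
    rw [Finset.sum_insert ha, add_mul, one_mul, mul_add, mul_one, Finset.mul_sum,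
      Finset.sum_eq_zero (s := s)
        (f := fun x => Matrix.single 0 a.succ (b a) * Matrix.single 0 x.succ (b x)), add_zero]
    · abel
    · intro x _
      rw [Matrix.single_mul_single_of_ne]
      exact Fin.succ_ne_zero a

theorem rowUnipotent_mem {n : ℕ} (b : Fin n → S) :
    rowUnipotent b ∈ elementaryDiagonal S (n + 1) :=
  elementaryMatrices_le _ (rowUnipotent_mem_elementaryMatrices b)

theorem rowUnipotent_apply_zero {n : ℕ} (b : Fin n → S) (j : Fin n) :
    rowUnipotent b 0 j.succ = b j := by
  rw [rowUnipotent, Matrix.add_apply, Matrix.sum_apply, Finset.sum_eq_single j]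
  · simp [(Fin.succ_ne_zero _).symm]
  · intro x _ hx
    simp [hx]
  · simp

theorem rowUnipotent_apply_zero_zero {n : ℕ} (b : Fin n → S) : rowUnipotent b 0 0 = 1 := by
  rw [rowUnipotent, Matrix.add_apply, Matrix.sum_apply, Finset.sum_eq_zero]
  · simp
  · intro x _
    simp

theorem rowUnipotent_apply_succ {n : ℕ} (b : Fin n → S) (i : Fin n) (l : Fin (n + 1)) :
    rowUnipotent b i.succ l = (1 : Matrix (Fin (n + 1)) (Fin (n + 1)) S) i.succ l := by
  rw [rowUnipotent, Matrix.add_apply, Matrix.sum_apply, Finset.sum_eq_zero, add_zero]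
  intro x _
  simp [(Fin.succ_ne_zero _).symm]

/-- A matrix whose first column vanishes below the diagonal factors through its blocks. -/
theorem eq_extendOne_mul_rowUnipotent_mul_diagonal {n : ℕ}
    (A : Matrix (Fin (n + 1)) (Fin (n + 1)) S) (hA : ∀ i : Fin n, A i.succ 0 = 0) :
    A = extendOne (Matrix.of fun i j => A i.succ j.succ) *
      (rowUnipotent (fun j => A 0 j.succ) * Matrix.diagonal (Fin.cons (A 0 0) 1)) := by
  ext i j
  refine Fin.cases ?_ (fun i => ?_) i <;> refine Fin.cases ?_ (fun j => ?_) j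
  · simp [Matrix.mul_apply, Fin.sum_univ_succ, Matrix.diagonal_apply,
      rowUnipotent_apply_zero_zero]
  · rw [Matrix.mul_apply, Fin.sum_univ_succ, Matrix.mul_diagonal]
    simp [rowUnipotent_apply_zero]
  · rw [Matrix.mul_apply, Fin.sum_univ_succ]
    simp [Matrix.mul_diagonal, rowUnipotent_apply_succ, hA, Fin.succ_ne_zero]
  · rw [Matrix.mul_apply, Fin.sum_univ_succ]
    simp [Matrix.mul_diagonal, rowUnipotent_apply_succ, Matrix.one_apply]

/-- Over a ring with left division with remainder, the diagonal matrices and the transvections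
generate the monoid of square matrices. -/
theorem elementaryDiagonal_eq_top (N : S → ℕ)
    (hN : ∀ s r : S, s ≠ 0 → ∃ q, r + q * s = 0 ∨ N (r + q * s) < N s) (n : ℕ) :
    elementaryDiagonal S n = ⊤ := by
  refine (Submonoid.eq_top_iff' _).2 fun A => ?_
  induction n with
  | zero => rw [Subsingleton.elim A 1]; exact one_mem _
  | succ n ih =>
    suffices H : ∃ P ∈ elementaryDiagonal S (n + 1), ∃ B : Matrix (Fin (n + 1)) (Fin (n + 1)) S,
        A = P * B ∧ ∀ i : Fin n, B i.succ 0 = 0 by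
      obtain ⟨P, hP, B, rfl, hB⟩ := H
      refine mul_mem hP ?_
      rw [eq_extendOne_mul_rowUnipotent_mul_diagonal B hB]
      exact mul_mem (extendOne_mem (ih _))
        (mul_mem (rowUnipotent_mem _) (diagonal_mem_elementaryDiagonal _))
    by_cases h0 : ∀ i, A i 0 = 0
    · exact ⟨1, one_mem _, A, by simp, fun i => h0 _⟩
    push Not at h0
    -- Euclidean descent: among all factorizations `A = P * B`, choose a nonzero first-column entry
    -- of `B` of least norm.
    have hex : ∃ m, ∃ P ∈ elementaryDiagonal S (n + 1), ∃ B i, A = P * B ∧ B i 0 ≠ 0 ∧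
        N (B i 0) = m := by
      obtain ⟨i, hi⟩ := h0
      exact ⟨_, 1, one_mem _, A, i, by simp, hi, rfl⟩
    classical
    obtain ⟨P, hP, B, i, hAB, hi, hm⟩ := Nat.find_spec hex
    choose q hq using fun j => hN (B i 0) (B j 0) hi
    -- A nonzero remainder would be a smaller first-column entry of another admissible
    -- factorization.
    have hclear : ∀ j ≠ i, B j 0 + q j * B i 0 = 0 := by
      intro j hj
      by_contra hz
      refine Nat.find_min hex (hm ▸ (hq j).resolve_left hz)
        ⟨P * columnUnipotent i (fun j => - q j), mul_mem hP (columnUnipotent_mem _ _),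
          columnUnipotent i q * B, j, ?_, ?_, ?_⟩
      · rw [mul_assoc, ← mul_assoc (columnUnipotent _ _), columnUnipotent_neg_mul, one_mul, hAB]
      · rw [columnUnipotent_mul_apply, if_neg hj]; exact hz
      · rw [columnUnipotent_mul_apply, if_neg hj]
    by_cases hi0 : i = 0
    · refine ⟨P * columnUnipotent i (fun j => - q j), mul_mem hP (columnUnipotent_mem _ _),
          columnUnipotent i q * B, ?_, fun j => ?_⟩
      · rw [mul_assoc, ← mul_assoc (columnUnipotent _ _), columnUnipotent_neg_mul, one_mul, hAB]
      · have hj : j.succ ≠ i := by rw [hi0]; exact Fin.succ_ne_zero j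
        rw [columnUnipotent_mul_apply, if_neg hj, hclear _ hj]
    -- The pivot is brought to the top without a permutation. The extra `1` in the coefficient of
    -- row `0` leaves `B i 0` there instead of `0`; subtracting row `0` from row `i` then clears the
    -- old pivot.
    · refine ⟨P * columnUnipotent i (fun j => - (q + (Pi.single 0 1 : Fin (n + 1) → S)) j) *
          columnUnipotent 0 (fun j => - (Pi.single i (-1) : Fin (n + 1) → S) j),
        mul_mem (mul_mem hP (columnUnipotent_mem _ _)) (columnUnipotent_mem _ _),
        columnUnipotent 0 (Pi.single i (-1)) * (columnUnipotent i (q + Pi.single 0 1) * B),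
        ?_, fun j => ?_⟩
      · rw [mul_assoc, ← mul_assoc (columnUnipotent 0 _), columnUnipotent_neg_mul, one_mul,
          mul_assoc, ← mul_assoc (columnUnipotent i _), columnUnipotent_neg_mul, one_mul, hAB]
      · have h00 := hclear 0 (Ne.symm hi0)
        rw [columnUnipotent_mul_apply, if_neg (Fin.succ_ne_zero j), columnUnipotent_mul_apply,
          columnUnipotent_mul_apply, if_neg (Ne.symm hi0)]
        by_cases hj : j.succ = i
        · subst hj
          simp [add_mul, ← add_assoc, h00]
        · rw [if_neg hj]
          simp [hj, Fin.succ_ne_zero, hclear _ hj]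

end Generation

/-! ### Homomorphisms from matrices to `ℤ ∪ {∞}` -/

section Additive

variable {S : Type*} [Ring S] {n : ℕ}

/-- Stated without inverses, so that it rescales transvections even when `c` is not a unit; a
homomorphism finite on the diagonal factor can cancel it. -/
theorem diagonal_update_mul_transvection {i j : Fin n} (h : i ≠ j) (c a : S) :
    Matrix.diagonal (Function.update 1 i c) * (1 + Matrix.single i j a) =
      (1 + Matrix.single i j (c * a)) * Matrix.diagonal (Function.update 1 i c) := by
  rw [mul_add, add_mul, mul_one, one_mul]
  congr 1
  ext x y
  rw [Matrix.diagonal_mul, Matrix.mul_diagonal, Matrix.single_apply, Matrix.single_apply]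
  split_ifs with hxy
  · obtain ⟨rfl, rfl⟩ := hxy
    simp [h.symm]
  · simp

theorem ne_top_of_mul_eq_one {f : Matrix (Fin n) (Fin n) S → WithTop ℤ}
    (hmul : ∀ A B, f (A * B) = f A + f B) (hone : f 1 = 0) {A B : Matrix (Fin n) (Fin n) S}
    (h : A * B = 1) : f A ≠ ⊤ := by
  intro hA
  have := hmul A B
  rw [h, hone, hA, top_add] at this
  exact WithTop.zero_ne_top this

theorem eq_zero_of_add_self {z : WithTop ℤ} (hz : z ≠ ⊤) (h : z + z = z) : z = 0 := by
  lift z to ℤ using hz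
  norm_cast at h ⊢
  omega

theorem transvection_mul_transvection {i j : Fin n} (h : i ≠ j) (a b : S) :
    (1 + Matrix.single i j a) * (1 + Matrix.single i j b) = 1 + Matrix.single i j (a + b) := by
  rw [add_mul, one_mul, mul_add, mul_one, Matrix.single_mul_single_of_ne _ _ _ _ h.symm,
    Matrix.single_add]
  abel

/-- A homomorphism which is finite on nonsingular diagonal matrices vanishes on transvections. -/
theorem map_transvection_eq_zero {f : Matrix (Fin n) (Fin n) S → WithTop ℤ}
    (hmul : ∀ A B, f (A * B) = f A + f B) (hone : f 1 = 0)
    (hdiag : ∀ d : Fin n → S, (∀ i, d i ≠ 0) → f (Matrix.diagonal d) ≠ ⊤)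
    {c : S} (hc : c ≠ 0) (hc' : 1 + c ≠ 0) {i j : Fin n} (h : i ≠ j) (a : S) :
    f (1 + Matrix.single i j a) = 0 := by
  nontriviality S using hone
  have hscale : ∀ a : S, a ≠ 0 → f (1 + Matrix.single i j a) = f (1 + Matrix.single i j 1) := by
    intro a ha
    have hd : f (Matrix.diagonal (Function.update 1 i a)) ≠ ⊤ := by
      refine hdiag _ fun l => ?_
      by_cases hl : l = i
      · subst hl; simpa using ha
      · simp [hl]
    have := congrArg f (diagonal_update_mul_transvection h a 1)
    rw [hmul, hmul, add_comm, mul_one] at this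
    exact ((WithTop.add_right_inj hd).1 this).symm
  have hfin : f (1 + Matrix.single i j 1) ≠ ⊤ := by
    refine ne_top_of_mul_eq_one hmul hone (B := 1 + Matrix.single i j (-1)) ?_
    rw [transvection_mul_transvection h]
    simp
  by_cases ha : a = 0
  · simpa [ha] using hone
  · rw [hscale a ha]
    -- The parameters `1`, `c` and `1 + c` are all nonzero, so the three transvections share one
    -- value `z`, and `z + z = z`.
    refine eq_zero_of_add_self hfin ?_
    have := hmul (1 + Matrix.single i j 1) (1 + Matrix.single i j c)
    rwa [transvection_mul_transvection h, hscale _ hc', hscale c hc, eq_comm] at this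

/-- Two homomorphisms on `M(n, S)` that agree on diagonal matrices are equal. -/
theorem eq_of_eq_on_diagonal {f g : Matrix (Fin n) (Fin n) S → WithTop ℤ}
    (hgen : elementaryDiagonal S n = ⊤)
    (hf : ∀ A B, f (A * B) = f A + f B) (hg : ∀ A B, g (A * B) = g A + g B)
    (hone : f 1 = 0) (hdiag : ∀ d : Fin n → S, (∀ i, d i ≠ 0) → f (Matrix.diagonal d) ≠ ⊤)
    {c : S} (hc : c ≠ 0) (hc' : 1 + c ≠ 0)
    (hfg : ∀ d, f (Matrix.diagonal d) = g (Matrix.diagonal d))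
    (A : Matrix (Fin n) (Fin n) S) : f A = g A := by
  have hA : A ∈ elementaryDiagonal S n := hgen ▸ Submonoid.mem_top A
  have h1 : f 1 = g 1 := by simpa using hfg 1
  induction hA using Submonoid.closure_induction with
  | mem A hA =>
    rcases hA with ⟨d, rfl⟩ | ⟨i, j, hij, a, rfl⟩
    · exact hfg d
    · rw [map_transvection_eq_zero hf hone hdiag hc hc' hij,
        map_transvection_eq_zero hg (h1 ▸ hone) (fun d hd => hfg d ▸ hdiag d hd) hc hc' hij]
  | one => exact h1
  | mul A B _ _ hA hB => rw [hf, hg, hA, hB]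

theorem map_elementaryMatrices_eq_zero {f : Matrix (Fin n) (Fin n) S → WithTop ℤ}
    (hmul : ∀ A B, f (A * B) = f A + f B) (hone : f 1 = 0)
    (hdiag : ∀ d : Fin n → S, (∀ i, d i ≠ 0) → f (Matrix.diagonal d) ≠ ⊤)
    {c : S} (hc : c ≠ 0) (hc' : 1 + c ≠ 0) {A : Matrix (Fin n) (Fin n) S}
    (hA : A ∈ elementaryMatrices S n) : f A = 0 := by
  induction hA using Submonoid.closure_induction with
  | mem A hA =>
    obtain ⟨i, j, hij, a, rfl⟩ := hA
    exact map_transvection_eq_zero hmul hone hdiag hc hc' hij a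
  | one => exact hone
  | mul A B _ _ hA hB => rw [hmul, hA, hB, add_zero]

/-- A permutation matrix has finite order, and `ℤ` is torsion-free; invertibility excludes the value
`∞`. -/
theorem map_submatrix_perm_one_eq_zero {f : Matrix (Fin n) (Fin n) S → WithTop ℤ}
    (hmul : ∀ A B, f (A * B) = f A + f B) (hone : f 1 = 0) (σ : Equiv.Perm (Fin n)) :
    f ((1 : Matrix (Fin n) (Fin n) S).submatrix σ id) = 0 := by
  have hst : ∀ σ τ : Equiv.Perm (Fin n), (1 : Matrix (Fin n) (Fin n) S).submatrix (σ * τ) id =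
      (1 : Matrix (Fin n) (Fin n) S).submatrix τ id *
        (1 : Matrix (Fin n) (Fin n) S).submatrix σ id := by
    intro σ τ
    exact (Matrix.one_submatrix_mul τ (Equiv.refl _)
      ((1 : Matrix (Fin n) (Fin n) S).submatrix σ id)).symm
  have hfin : f ((1 : Matrix (Fin n) (Fin n) S).submatrix σ id) ≠ ⊤ := by
    refine ne_top_of_mul_eq_one hmul hone
      (B := (1 : Matrix (Fin n) (Fin n) S).submatrix (σ⁻¹ : Equiv.Perm (Fin n)) id) ?_
    rw [← hst, inv_mul_cancel]
    rfl
  have hpow : ∀ m : ℕ, f ((1 : Matrix (Fin n) (Fin n) S).submatrix (σ ^ m : Equiv.Perm (Fin n)) id)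
      = m • f ((1 : Matrix (Fin n) (Fin n) S).submatrix σ id) := by
    intro m
    induction m with
    | zero => simpa using hone
    | succ m ih => rw [pow_succ, hst, hmul, ih, succ_nsmul']
  have h := hpow (orderOf σ)
  rw [pow_orderOf_eq_one, Equiv.Perm.coe_one, Matrix.submatrix_id_id, hone] at h
  generalize f ((1 : Matrix (Fin n) (Fin n) S).submatrix σ id) = z at h hfin
  lift z to ℤ using hfin
  have h' : (0 : ℤ) = orderOf σ • z := by exact_mod_cast h
  rw [nsmul_eq_mul, eq_comm, mul_eq_zero] at h'
  have := (orderOf_pos σ).ne'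
  exact_mod_cast h'.resolve_left (by exact_mod_cast this)

theorem map_submatrix_perm {f : Matrix (Fin n) (Fin n) S → WithTop ℤ}
    (hmul : ∀ A B, f (A * B) = f A + f B) (hone : f 1 = 0) (σ : Equiv.Perm (Fin n))
    (A : Matrix (Fin n) (Fin n) S) : f (A.submatrix σ id) = f A := by
  have h : (1 : Matrix (Fin n) (Fin n) S).submatrix σ id * A = A.submatrix σ id :=
    Matrix.one_submatrix_mul σ (Equiv.refl _) A
  rw [← h, hmul, map_submatrix_perm_one_eq_zero hmul hone, zero_add]

end Additive

/-! ### Gaussian elimination over a skew field -/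

section Elimination

variable {D : Type*} [DivisionRing D]

theorem elementaryDiagonal_divisionRing (n : ℕ) : elementaryDiagonal D n = ⊤ :=
  elementaryDiagonal_eq_top (fun _ => 0) (fun s r hs => ⟨-(r * s⁻¹), Or.inl (by simp [hs])⟩) n

/-- Any family of homomorphisms `M(n, D) → ℤ ∪ {∞}` given on diagonal matrices by the sum of the
values of `v` obeys the recursion of Gaussian elimination. -/
theorem map_eq_of_pivot {v : D → WithTop ℤ} {F : ∀ n, Matrix (Fin n) (Fin n) D → WithTop ℤ}
    (hmul : ∀ n A B, F n (A * B) = F n A + F n B)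
    (hdiag : ∀ n (d : Fin n → D), F n (Matrix.diagonal d) = ∑ i, v (d i))
    (hv1 : v 1 = 0) (hv : ∀ a, a ≠ 0 → v a ≠ ⊤) {c : D} (hc : c ≠ 0) (hc' : 1 + c ≠ 0)
    {n : ℕ} (A : Matrix (Fin (n + 1)) (Fin (n + 1)) D) (i : Fin (n + 1)) (hi : A i 0 ≠ 0) :
    F (n + 1) A = v (A i 0) + F n (Matrix.of fun j l =>
      A (i.succAbove j) l.succ - A (i.succAbove j) 0 * (A i 0)⁻¹ * A i l.succ) := by
  have hone : ∀ n, F n 1 = 0 := fun n => by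
    rw [← Matrix.diagonal_one, hdiag]
    simp [hv1]
  have hfin : ∀ n (d : Fin n → D), (∀ i, d i ≠ 0) → F n (Matrix.diagonal d) ≠ ⊤ := by
    intro n d hd
    rw [hdiag, WithTop.sum_ne_top]
    exact fun i _ => hv _ (hd i)
  -- Both sides are homomorphisms in `B` with the same diagonal values, as `v 1 = 0`, so uniqueness
  -- over `D` relates consecutive sizes.
  have hext : ∀ B : Matrix (Fin n) (Fin n) D, F (n + 1) (extendOne B) = F n B := by
    refine eq_of_eq_on_diagonal (f := fun B => F (n + 1) (extendOne B)) (g := F n)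
      (elementaryDiagonal_divisionRing n) (fun A B => ?_) (hmul n) ?_ (fun d hd => ?_) hc hc'
      (fun d => ?_)
    · simp only [extendOne_mul, hmul]
    · simp only [extendOne_one, hone]
    · simp only [extendOne_diagonal]
      refine hfin _ _ fun i => ?_
      refine Fin.cases ?_ (fun i => ?_) i
      · exact right_ne_zero_of_mul (a := c) (by simpa using hc)
      · simpa using hd i
    · simp only [extendOne_diagonal, hdiag, Fin.sum_univ_succ, Fin.cons_zero, Fin.cons_succ, hv1,
        zero_add]
  -- This cycle moves row `i` to the top and keeps the others in order, matching `succAbove` in the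
  -- recursion of `dieudonneDet`.
  obtain ⟨B, hB⟩ : ∃ B, B = A.submatrix i.cycleRange.symm id := ⟨_, rfl⟩
  have hB0 : ∀ l, B 0 l = A i l := fun l => by simp [hB, Fin.cycleRange_symm_zero]
  have hBs : ∀ j l, B j.succ l = A (i.succAbove j) l := fun j l => by
    simp [hB, Fin.cycleRange_symm_succ]
  obtain ⟨E, hE⟩ : ∃ E, E = columnUnipotent 0 (fun j => - (B j 0 * (A i 0)⁻¹)) * B := ⟨_, rfl⟩
  have hE0 : ∀ l, E 0 l = A i l := fun l => by
    rw [hE, columnUnipotent_mul_apply, if_pos rfl, hB0]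
  have hEs : ∀ j l, E (Fin.succ j) l =
      A (i.succAbove j) l - A (i.succAbove j) 0 * (A i 0)⁻¹ * A i l := fun j l => by
    rw [hE, columnUnipotent_mul_apply, if_neg (Fin.succ_ne_zero j), hB0, hBs, hBs, neg_mul,
      sub_eq_add_neg]
  have hFE : F (n + 1) E = F (n + 1) A := by
    rw [hE, hmul, map_elementaryMatrices_eq_zero (hmul _) (hone _) (hfin _) hc hc'
      (columnUnipotent_mem_elementaryMatrices _ _), zero_add, hB,
      map_submatrix_perm (hmul _) (hone _)]
  have hcol : ∀ j : Fin n, E j.succ 0 = 0 := fun j => by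
    rw [hEs, mul_assoc, inv_mul_cancel₀ hi, mul_one, sub_self]
  rw [← hFE, eq_extendOne_mul_rowUnipotent_mul_diagonal E hcol, hmul, hmul,
    map_elementaryMatrices_eq_zero (hmul _) (hone _) (hfin _) hc hc'
      (rowUnipotent_mem_elementaryMatrices _), hext, hdiag, zero_add, add_comm]
  congr 1
  · simp [Fin.sum_univ_succ, hE0, hv1]
  · simp only [hEs]

/-- Such a matrix is unchanged by right multiplication by `diag(0, 1, …, 1)`, whose value is `∞`. -/
theorem map_eq_top_of_column_eq_zero {v : D → WithTop ℤ} {n : ℕ}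
    {f : Matrix (Fin (n + 1)) (Fin (n + 1)) D → WithTop ℤ}
    (hmul : ∀ A B, f (A * B) = f A + f B)
    (hdiag : ∀ d, f (Matrix.diagonal d) = ∑ i, v (d i)) (hv0 : v 0 = ⊤)
    (A : Matrix (Fin (n + 1)) (Fin (n + 1)) D) (hA : ∀ i, A i 0 = 0) : f A = ⊤ := by
  have h : A = A * Matrix.diagonal (Fin.cons 0 1) := by
    ext i j
    rw [Matrix.mul_diagonal]
    refine Fin.cases ?_ (fun j => ?_) j
    · simp [hA]
    · simp
  rw [h, hmul, hdiag, Fin.sum_univ_succ, Fin.cons_zero, hv0, top_add, add_top]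

end Elimination

/-! ### Characterization of the degree of the Dieudonné determinant -/

namespace SkewPoly

variable {k : Type u} [Field k] {α : k →+* k} (δ : SkewDerivation α)

theorem degAb_one : degAb δ 1 = 0 := by
  have h := degAb_divAbClass δ 1
  rw [degFrac_one] at h
  rw [← h]
  congr 1
  simp [divAbClass]

theorem degAb_mul (a b : DivAb (Frac δ)) : degAb δ (a * b) = degAb δ a + degAb δ b := by
  induction a using WithZero.recZeroCoe with
  | zero => simp [degAb]
  | coe a =>
    induction b using WithZero.recZeroCoe with
    | zero => simp [degAb]
    | coe b =>
      change ((Multiplicative.toAdd (Abelianization.lift (degUnits δ) (a * b)) : ℤ) : WithTop ℤ) = _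
      rw [map_mul, toAdd_mul, WithTop.coe_add]
      rfl

theorem degFrac_zero : degFrac δ 0 = ⊤ := by
  rw [← degAb_divAbClass, divAbClass, dif_pos rfl]
  rfl

theorem degFrac_neg_one : degFrac δ (-1) = 0 := by
  have h := degFrac_mul δ (-1) (-1)
  have hfin : degFrac δ (-1) ≠ ⊤ := degFrac_ne_top δ _ (by simp)
  rw [neg_one_mul, neg_neg, degFrac_one] at h
  generalize degFrac δ (-1) = z at h hfin
  lift z to ℤ using hfin
  norm_cast at h ⊢
  omega

theorem degAb_pow_eq_zero {a : DivAb (Frac δ)} (ha : degAb δ a = 0) (m : ℕ) :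
    degAb δ (a ^ m) = 0 := by
  induction m with
  | zero => rw [pow_zero, degAb_one]
  | succ m ih => rw [pow_succ, degAb_mul, ih, ha, add_zero]

open Classical in
/-- The degree of the Dieudonné determinant is the unique family of homomorphisms which on
diagonal matrices is the sum of the degrees. -/
theorem degDetFrac_eq {F : ∀ n, Matrix (Fin n) (Fin n) (Frac δ) → WithTop ℤ}
    (hmul : ∀ n A B, F n (A * B) = F n A + F n B)
    (hdiag : ∀ n (d : Fin n → Frac δ), F n (Matrix.diagonal d) = ∑ i, degFrac δ (d i))
    {c : Frac δ} (hc : c ≠ 0) (hc' : 1 + c ≠ 0)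
    {n : ℕ} (A : Matrix (Fin n) (Fin n) (Frac δ)) : degDetFrac δ A = F n A := by
  induction n with
  | zero =>
    rw [Subsingleton.elim A (Matrix.diagonal 0), hdiag, degDetFrac, dieudonneDet, degAb_one]
    simp
  | succ n ih =>
    rw [degDetFrac, dieudonneDet]
    split_ifs with h
    -- The sign from the row interchanges disappears because `-1` has degree `0`.
    · rw [map_eq_of_pivot hmul hdiag (degFrac_one δ) (degFrac_ne_top δ) hc hc' A _
        (Fin.find_spec h), degAb_mul, degAb_mul, degAb_divAbClass, degAb_pow_eq_zero, zero_add]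
      · congr 1
        exact ih _
      · rw [degAb_divAbClass, degFrac_neg_one]
    · push Not at h
      rw [map_eq_top_of_column_eq_zero (hmul _) (hdiag _) (degFrac_zero δ) A h]
      rfl

end SkewPoly

/-! ### The dimension of the cokernel -/

namespace SkewPoly

variable {k : Type u} [Field k] {α : k →+* k} (δ : SkewDerivation α)

/-- The identification of left `k`-vector spaces of `k[x; α, δ]` with `k[X]`. -/
noncomputable def toPolyEquiv : SkewPoly δ ≃ₗ[k] Polynomial k where
  toFun := toPoly
  invFun := ofPoly
  map_add' _ _ := rfl
  map_smul' _ _ := rfl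
  left_inv _ := rfl
  right_inv _ := rfl

theorem not_finite : ¬ Module.Finite k (SkewPoly δ) := fun _ =>
  Polynomial.not_finite (R := k) (Module.Finite.equiv (toPolyEquiv δ))

theorem toFrac_injective : Function.Injective (toFrac δ) :=
  OreLocalization.numeratorHom_inj inf_le_left

theorem map_toFrac_injective {n : ℕ} : Function.Injective
    (fun A : Matrix (Fin n) (Fin n) (SkewPoly δ) => A.map (toFrac δ)) :=
  Matrix.map_injective (toFrac_injective δ)

theorem toFrac_ne_zero {r : SkewPoly δ} (hr : r ≠ 0) : toFrac δ r ≠ 0 :=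
  (map_ne_zero_iff _ (toFrac_injective δ)).2 hr

/-- One-sided inverses of matrices are two-sided over the skew field `Q`, and this descends to the
subring `R`. -/
instance : IsStablyFiniteRing (SkewPoly δ) :=
  .of_injective (toFrac δ) (toFrac_injective δ)

section Coker

variable {n : ℕ} (A B : Matrix (Fin n) (Fin n) (SkewPoly δ))

theorem mem_rowModule {v : Fin n → SkewPoly δ} :
    v ∈ rowModule δ A ↔ ∃ w, Matrix.vecMul w A = v := Iff.rfl

theorem rowModule_mul_le : rowModule δ (A * B) ≤ rowModule δ B := by
  rintro _ ⟨w, rfl⟩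
  exact ⟨Matrix.vecMul w A, by simp [Matrix.vecMul_vecMul]⟩

/-- The projection `Rⁿ / Rⁿ A B → Rⁿ / Rⁿ B`. -/
noncomputable def cokerProj : ((Fin n → SkewPoly δ) ⧸ rowModule δ (A * B)) →ₗ[k]
    ((Fin n → SkewPoly δ) ⧸ rowModule δ B) :=
  (Submodule.factor (rowModule_mul_le δ A B)).restrictScalars k

theorem cokerProj_surjective : Function.Surjective (cokerProj δ A B) := fun x => by
    obtain ⟨v, rfl⟩ := Submodule.Quotient.mk_surjective _ x
    exact ⟨Submodule.Quotient.mk v, rfl⟩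

/-- The map `Rⁿ / Rⁿ A → Rⁿ / Rⁿ A B` induced by right multiplication by `B`. -/
noncomputable def cokerMul : ((Fin n → SkewPoly δ) ⧸ rowModule δ A) →ₗ[k]
    ((Fin n → SkewPoly δ) ⧸ rowModule δ (A * B)) :=
  (Submodule.mapQ (rowModule δ A) (rowModule δ (A * B)) B.vecMulLinear (by
    rintro _ ⟨w, rfl⟩
    exact ⟨w, by simp [Matrix.vecMul_vecMul]⟩)).restrictScalars k

theorem cokerMul_injective (hB : Function.Injective B.vecMulLinear) :
    Function.Injective (cokerMul δ A B) := by
  rw [injective_iff_map_eq_zero]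
  intro x hx
  obtain ⟨v, rfl⟩ := Submodule.Quotient.mk_surjective _ x
  have hx' : Matrix.vecMul v B ∈ rowModule δ (A * B) := (Submodule.Quotient.mk_eq_zero _).1 hx
  obtain ⟨w, hw⟩ := hx'
  rw [Submodule.Quotient.mk_eq_zero]
  refine ⟨w, hB ?_⟩
  simpa [Matrix.vecMul_vecMul] using hw

theorem range_cokerMul : LinearMap.range (cokerMul δ A B) = LinearMap.ker (cokerProj δ A B) := by
  ext x
  obtain ⟨v, rfl⟩ := Submodule.Quotient.mk_surjective _ x
  rw [LinearMap.mem_ker, LinearMap.mem_range]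
  constructor
  · rintro ⟨y, hy⟩
    obtain ⟨w, rfl⟩ := Submodule.Quotient.mk_surjective _ y
    rw [← hy]
    exact (Submodule.Quotient.mk_eq_zero _).2 ⟨w, rfl⟩
  · intro h
    obtain ⟨w, rfl⟩ := (Submodule.Quotient.mk_eq_zero (rowModule δ B) (x := v)).1 h
    exact ⟨Submodule.Quotient.mk w, rfl⟩

/-- A finite-dimensional cokernel is torsion, which forces `B` to be invertible over `Q`. -/
theorem vecMulLinear_injective_of_cokerDim_ne_top (hB : cokerDim δ B ≠ ⊤) :
    Function.Injective B.vecMulLinear := by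
  rw [cokerDim, Cardinal.toENat_ne_top, Module.rank_lt_aleph0_iff] at hB
  have htors : ∀ i, ∃ s : SkewPoly δ, s ≠ 0 ∧ ∃ w, Matrix.vecMul w B = Pi.single i s := by
    intro i
    by_contra! hcon
    let g : SkewPoly δ →ₗ[k] ((Fin n → SkewPoly δ) ⧸ rowModule δ B) :=
      ((rowModule δ B).mkQ ∘ₗ LinearMap.single (SkewPoly δ) (fun _ => SkewPoly δ) i).restrictScalars k
    -- If no nonzero multiple of the `i`-th basis vector lay in `RⁿB`, then `s ↦ s eᵢ` would embed
    -- the infinite-dimensional `R` in the cokernel.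
    refine not_finite δ (Module.Finite.of_injective g ?_)
    rw [injective_iff_map_eq_zero]
    intro s hs
    by_contra hs0
    obtain ⟨w, hw⟩ := (Submodule.Quotient.mk_eq_zero (rowModule δ B)
      (x := (Pi.single i s : Fin n → SkewPoly δ))).1 (by simpa [g] using hs)
    exact hcon s hs0 w hw
  choose s hs w hw using htors
  have hWB : Matrix.of w * B = Matrix.diagonal s := by
    refine Matrix.ext fun i j => ?_
    rw [Matrix.mul_apply_eq_vecMul]
    change Matrix.vecMul (w i) B j = _
    rw [hw, Matrix.diagonal_apply, Pi.single_apply]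
    simp only [eq_comm]
  have hinv : (Matrix.diagonal (fun i => (toFrac δ (s i))⁻¹) * (Matrix.of w).map (toFrac δ)) *
      B.map (toFrac δ) = 1 := by
    rw [mul_assoc, ← Matrix.map_mul, hWB, Matrix.diagonal_map (map_zero _),
      Matrix.diagonal_mul_diagonal, ← Matrix.diagonal_one]
    congr 1
    ext i
    exact inv_mul_cancel₀ (toFrac_ne_zero δ (hs i))
  have hinv' := mul_eq_one_symm hinv
  rw [injective_iff_map_eq_zero]
  intro v hv
  have hv' : Matrix.vecMul (toFrac δ ∘ v) (B.map (toFrac δ)) = 0 := by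
    ext i
    rw [← RingHom.map_vecMul]
    have := congrFun hv i
    simp only [Matrix.vecMulLinear_apply] at this
    rw [this]
    simp
  have h0 : toFrac δ ∘ v = 0 := by
    rw [← Matrix.vecMul_one (toFrac δ ∘ v), ← hinv', ← Matrix.vecMul_vecMul, hv',
      Matrix.zero_vecMul]
  ext1 i
  exact toFrac_injective δ (by simpa using congrFun h0 i)

/-- If `Rⁿ/RⁿB` is infinite-dimensional, so is `Rⁿ/RⁿAB`, which surjects onto it. Otherwise
`cokerMul` and `cokerProj` form a short exact sequence. -/
theorem cokerDim_mul : cokerDim δ (A * B) = cokerDim δ A + cokerDim δ B := by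
  by_cases hB : cokerDim δ B = ⊤
  · rw [hB, add_top, eq_top_iff, ← hB]
    exact Cardinal.toENat.monotone'
      (LinearMap.rank_le_of_surjective _ (cokerProj_surjective δ A B))
  · have hinj := cokerMul_injective δ A B (vecMulLinear_injective_of_cokerDim_ne_top δ B hB)
    rw [cokerDim, ← LinearMap.rank_range_add_rank_ker (cokerProj δ A B), ← range_cokerMul,
      rank_range_of_injective _ hinj, rank_range_of_surjective _ (cokerProj_surjective δ A B),
      map_add, add_comm]
    rfl

theorem cokerDim_one : cokerDim δ (1 : Matrix (Fin n) (Fin n) (SkewPoly δ)) = 0 := by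
  rw [cokerDim, Cardinal.toENat_eq_zero, rank_zero_iff, Submodule.Quotient.subsingleton_iff,
    eq_top_iff]
  exact fun v _ => ⟨v, by simp⟩

/-- A zero cokernel provides a left inverse row by row, and stable finiteness makes it two-sided.
Conversely the values at a unit and its inverse add up to `0` in `ℕ ∪ {∞}`. -/
theorem cokerDim_eq_zero_iff : cokerDim δ A = 0 ↔ IsUnit A := by
  constructor
  · intro h
    rw [cokerDim, Cardinal.toENat_eq_zero, rank_zero_iff,
      Submodule.Quotient.subsingleton_iff] at h
    have hw : ∀ i, ∃ w, Matrix.vecMul w A = Pi.single i 1 := fun i => by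
      rw [← mem_rowModule, h]
      trivial
    choose w hw using hw
    have hWA : Matrix.of w * A = 1 := by
      refine Matrix.ext fun i j => ?_
      rw [Matrix.mul_apply_eq_vecMul]
      change Matrix.vecMul (w i) A j = _
      rw [hw, Matrix.one_apply, Pi.single_apply]
      simp only [eq_comm]
    exact ⟨⟨A, Matrix.of w, mul_eq_one_symm hWA, hWA⟩, rfl⟩
  · rintro ⟨U, rfl⟩
    have h := cokerDim_mul δ (U : Matrix (Fin n) (Fin n) (SkewPoly δ)) (U⁻¹ : (Matrix _ _ _)ˣ)
    rw [Units.mul_inv, cokerDim_one, eq_comm, add_eq_zero] at h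
    exact h.1

end Coker

/-! ### Cokernels of diagonal matrices -/

section Diagonal

open Submodule in
-- Division with remainder: each class modulo `R d` has exactly one representative of degree less
-- than that of `d`.
theorem rank_quotient_span_singleton {d : SkewPoly δ} (hd : d ≠ 0) :
    Module.rank k (SkewPoly δ ⧸ span (SkewPoly δ) {d}) = natDegree δ d := by
  have hd' : d.toPoly ≠ 0 := mt (toPoly_eq_zero δ).1 hd
  let g : Polynomial.degreeLT k (natDegree δ d) →ₗ[k] (SkewPoly δ ⧸ span (SkewPoly δ) {d}) :=
    ((span (SkewPoly δ) {d}).mkQ.restrictScalars k) ∘ₗ (toPolyEquiv δ).symm.toLinearMap ∘ₗ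
      (Polynomial.degreeLT k (natDegree δ d)).subtype
  have hdeg : d.toPoly.degree = natDegree δ d := Polynomial.degree_eq_natDegree hd'
  have hg : Function.Bijective g := by
    constructor
    · rw [injective_iff_map_eq_zero]
      rintro ⟨p, hp⟩ h
      obtain ⟨a, ha⟩ := mem_span_singleton.1 ((Submodule.Quotient.mk_eq_zero _).1 h)
      have ha' : mulAux δ a.toPoly d.toPoly = p := congrArg toPoly ha
      rw [Polynomial.mem_degreeLT, ← ha', degree_mulAux, hdeg] at hp
      have ha0 : a.toPoly = 0 := by
        by_contra h0
        rw [Polynomial.degree_eq_natDegree h0] at hp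
        norm_cast at hp
        omega
      ext1
      change p = 0
      rw [← ha', ha0, zero_mulAux]
    · intro x
      obtain ⟨r, rfl⟩ := Submodule.Quotient.mk_surjective _ x
      obtain ⟨q, t, rfl, ht⟩ := exists_div δ d hd r
      refine ⟨⟨t.toPoly, Polynomial.mem_degreeLT.2 (hdeg ▸ ht)⟩, ?_⟩
      refine (Submodule.Quotient.eq _).2 (mem_span_singleton.2 ⟨-q, ?_⟩)
      change -q * d = t - (q * d + t)
      rw [neg_mul]
      abel
  rw [← (LinearEquiv.ofBijective g hg).rank_eq, (Polynomial.degreeLTEquiv k _).rank_eq, rank_fin_fun]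

theorem toENat_rank_pi {n : ℕ} (V : Fin n → Type u) [∀ i, AddCommGroup (V i)]
    [∀ i, Module k (V i)] : Cardinal.toENat (Module.rank k (∀ i, V i)) =
      ∑ i, Cardinal.toENat (Module.rank k (V i)) := by
  induction n with
  | zero => simp
  | succ n ih =>
    rw [← (Fin.consLinearEquiv k V).rank_eq, rank_prod', map_add, ih, Fin.sum_univ_succ]

theorem cokerDim_diagonal {n : ℕ} (d : Fin n → SkewPoly δ) : cokerDim δ (Matrix.diagonal d) =
    ∑ i, Cardinal.toENat (Module.rank k
      (SkewPoly δ ⧸ Submodule.span (SkewPoly δ) {d i})) := by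
  rw [← toENat_rank_pi, cokerDim]
  let g : (Fin n → SkewPoly δ) →ₗ[SkewPoly δ]
      (∀ i, SkewPoly δ ⧸ Submodule.span (SkewPoly δ) {d i}) :=
    LinearMap.pi fun i => (Submodule.mkQ _) ∘ₗ LinearMap.proj i
  have hg : Function.Surjective g := by
    intro y
    choose v hv using fun i => Submodule.Quotient.mk_surjective _ (y i)
    exact ⟨v, funext hv⟩
  have hker : rowModule δ (Matrix.diagonal d) = LinearMap.ker g := by
    ext v
    have : v ∈ LinearMap.ker g ↔ ∀ i, v i ∈ Submodule.span (SkewPoly δ) {d i} := by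
      rw [LinearMap.mem_ker, funext_iff]
      exact forall_congr' fun i => Submodule.Quotient.mk_eq_zero _
    rw [this, mem_rowModule]
    simp only [Submodule.mem_span_singleton]
    constructor
    · rintro ⟨w, rfl⟩ i
      exact ⟨w i, by simp [Matrix.vecMul_diagonal]⟩
    · intro h
      choose w hw using h
      exact ⟨w, funext fun i => by simpa [Matrix.vecMul_diagonal] using hw i⟩
  exact congrArg _ ((Submodule.quotEquivOfEq _ _ hker).trans
    (LinearMap.quotKerEquivOfSurjective g hg) |>.restrictScalars k).rank_eq

theorem degFrac_toFrac {d : SkewPoly δ} (hd : d ≠ 0) :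
    degFrac δ (toFrac δ d) = ((natDegree δ d : ℤ) : WithTop ℤ) := by
  change degFrac δ (OreLocalization.oreDiv d 1) = _
  rw [degFrac_oreDiv, if_neg hd]
  simp [natDegree, toPoly_one]

theorem natToIntTop_toENat_rank (d : SkewPoly δ) :
    natToIntTop (Cardinal.toENat (Module.rank k
      (SkewPoly δ ⧸ Submodule.span (SkewPoly δ) {d}))) = degFrac δ (toFrac δ d) := by
  by_cases hd : d = 0
  · rw [hd, map_zero, degFrac_zero, Cardinal.toENat_eq_top.2]
    · rfl
    · by_contra h
      rw [not_le, Module.rank_lt_aleph0_iff] at h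
      refine not_finite δ (Module.Finite.equiv
        ((Submodule.quotEquivOfEqBot (Submodule.span (SkewPoly δ) {(0 : SkewPoly δ)})
          (by simp)).restrictScalars k))
  · rw [rank_quotient_span_singleton δ hd, degFrac_toFrac δ hd, map_natCast]
    rfl

theorem natToIntTop_add (a b : ℕ∞) : natToIntTop (a + b) = natToIntTop a + natToIntTop b := by
  induction a using ENat.recTopCoe with
  | top => rw [top_add]; exact (top_add _).symm
  | coe a =>
    induction b using ENat.recTopCoe with
    | top => rw [add_top]; exact (add_top _).symm
    | coe b =>
      change (((a + b : ℕ) : ℤ) : WithTop ℤ) = ((a : ℤ) : WithTop ℤ) + ((b : ℤ) : WithTop ℤ)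
      push_cast
      rfl

theorem natToIntTop_sum {ι : Type*} (s : Finset ι) (f : ι → ℕ∞) :
    natToIntTop (∑ i ∈ s, f i) = ∑ i ∈ s, natToIntTop (f i) :=
  map_sum (⟨⟨natToIntTop, rfl⟩, natToIntTop_add⟩ : ℕ∞ →+ WithTop ℤ) f s

theorem natToIntTop_cokerDim_diagonal {n : ℕ} (d : Fin n → SkewPoly δ) :
    natToIntTop (cokerDim δ (Matrix.diagonal d)) = ∑ i, degFrac δ (toFrac δ (d i)) := by
  simp only [cokerDim_diagonal, natToIntTop_sum, natToIntTop_toENat_rank]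

end Diagonal

end SkewPoly

/-! ### Euclidean generation of `M(n, R)` and common denominators -/

namespace SkewPoly

variable {k : Type u} [Field k] {α : k →+* k} (δ : SkewDerivation α)

theorem X_ne_zero : X δ ≠ 0 := fun h => Polynomial.X_ne_zero (congrArg toPoly h)

/-- Supplies `c = x` with `c` and `1 + c` nonzero; no constant would do for `k = 𝔽₂`. -/
theorem one_add_X_ne_zero : 1 + X δ ≠ 0 := fun h => by
  have h' : (1 : Polynomial k) + Polynomial.X = 0 := congrArg toPoly h
  have := congrArg (fun p => Polynomial.coeff p 1) h'
  simp [Polynomial.coeff_one] at this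

theorem elementaryDiagonal_skewPoly (n : ℕ) : elementaryDiagonal (SkewPoly δ) n = ⊤ := by
  refine elementaryDiagonal_eq_top (natDegree δ) (fun s r hs => ?_) n
  obtain ⟨q, t, h, ht⟩ := exists_div δ s hs r
  refine ⟨-q, ?_⟩
  have hr : r + -q * s = t := by rw [h, neg_mul]; abel
  rw [hr]
  by_cases h0 : t = 0
  · exact Or.inl h0
  · exact Or.inr (Polynomial.natDegree_lt_natDegree (mt (toPoly_eq_zero δ).1 h0) ht)

/-! ### Common denominators -/

theorem exists_denominator (q : Frac δ) :
    ∃ s r : SkewPoly δ, s ≠ 0 ∧ toFrac δ s * q = toFrac δ r := by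
  induction q using OreLocalization.ind with | _ r s
  exact ⟨s, r, nonZeroDivisors.coe_ne_zero s, OreLocalization.mul_cancel⟩

theorem exists_common_denominator {ι : Type*} [Finite ι] (q : ι → Frac δ) :
    ∃ s : SkewPoly δ, s ≠ 0 ∧ ∀ i, ∃ r, toFrac δ s * q i = toFrac δ r := by
  classical
  cases nonempty_fintype ι
  suffices H : ∀ t : Finset ι, ∃ s : SkewPoly δ, s ≠ 0 ∧ ∀ i ∈ t, ∃ r, toFrac δ s * q i = toFrac δ r by
    obtain ⟨s, hs, h⟩ := H Finset.univ
    exact ⟨s, hs, fun i => h i (Finset.mem_univ i)⟩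
  intro t
  induction t using Finset.induction_on with
  | empty => exact ⟨1, one_ne_zero, by simp⟩
  | insert a t _ ih =>
    obtain ⟨s, hs, h⟩ := ih
    obtain ⟨u, r, hu, hr⟩ := exists_denominator δ (toFrac δ s * q a)
    refine ⟨u * s, mul_ne_zero hu hs, fun i hi => ?_⟩
    rcases Finset.mem_insert.1 hi with rfl | hi
    · exact ⟨r, by rw [map_mul, mul_assoc, hr]⟩
    · obtain ⟨r', hr'⟩ := h i hi
      exact ⟨u * r', by rw [map_mul, mul_assoc, hr', map_mul]⟩

/-! ### Extension of the cokernel dimension to matrices over `Q` -/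

section Extension

variable {n : ℕ}

/-- The scalar matrix with diagonal entry `s`. -/
noncomputable def scalarMatrix (n : ℕ) (s : SkewPoly δ) : Matrix (Fin n) (Fin n) (SkewPoly δ) :=
  Matrix.diagonal fun _ => s

theorem scalarMatrix_mul (s t : SkewPoly δ) :
    scalarMatrix δ n (s * t) = scalarMatrix δ n s * scalarMatrix δ n t :=
  (Matrix.diagonal_mul_diagonal _ _).symm

theorem exists_common_denominator_matrix (A : Matrix (Fin n) (Fin n) (Frac δ)) :
    ∃ s : SkewPoly δ, s ≠ 0 ∧ ∃ B : Matrix (Fin n) (Fin n) (SkewPoly δ),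
      (scalarMatrix δ n s).map (toFrac δ) * A = B.map (toFrac δ) := by
  obtain ⟨s, hs, h⟩ := exists_common_denominator δ (fun p : Fin n × Fin n => A p.1 p.2)
  choose r hr using h
  refine ⟨s, hs, Matrix.of fun i j => r (i, j), ?_⟩
  refine Matrix.ext fun i j => ?_
  rw [scalarMatrix, Matrix.diagonal_map (map_zero _), Matrix.diagonal_mul]
  exact hr (i, j)

/-- The dimension of the cokernel, with values in `ℤ ∪ {∞}`. -/
noncomputable def cokerDimInt (A : Matrix (Fin n) (Fin n) (SkewPoly δ)) : WithTop ℤ :=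
  natToIntTop (cokerDim δ A)

theorem cokerDimInt_mul (A B : Matrix (Fin n) (Fin n) (SkewPoly δ)) :
    cokerDimInt δ (A * B) = cokerDimInt δ A + cokerDimInt δ B := by
  rw [cokerDimInt, cokerDim_mul, natToIntTop_add]
  rfl

theorem cokerDimInt_diagonal (d : Fin n → SkewPoly δ) :
    cokerDimInt δ (Matrix.diagonal d) = ∑ i, degFrac δ (toFrac δ (d i)) :=
  natToIntTop_cokerDim_diagonal δ d

theorem cokerDimInt_diagonal_ne_top (d : Fin n → SkewPoly δ) (hd : ∀ i, d i ≠ 0) :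
    cokerDimInt δ (Matrix.diagonal d) ≠ ⊤ := by
  rw [cokerDimInt_diagonal, WithTop.sum_ne_top]
  exact fun i _ => degFrac_ne_top δ _ (toFrac_ne_zero δ (hd i))

theorem cokerDimInt_scalarMatrix_ne_top {s : SkewPoly δ} (hs : s ≠ 0) :
    cokerDimInt δ (scalarMatrix δ n s) ≠ ⊤ :=
  cokerDimInt_diagonal_ne_top δ _ fun _ => hs

theorem cokerDimInt_one : cokerDimInt δ (1 : Matrix (Fin n) (Fin n) (SkewPoly δ)) = 0 := by
  rw [cokerDimInt, cokerDim_one]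
  rfl

theorem exists_index (A : Matrix (Fin n) (Fin n) (Frac δ)) : ∃ z : WithTop ℤ,
    ∃ s : SkewPoly δ, s ≠ 0 ∧ ∃ B : Matrix (Fin n) (Fin n) (SkewPoly δ),
      (scalarMatrix δ n s).map (toFrac δ) * A = B.map (toFrac δ) ∧
      z + cokerDimInt δ (scalarMatrix δ n s) = cokerDimInt δ B := by
  obtain ⟨s, hs, B, h⟩ := exists_common_denominator_matrix δ A
  obtain ⟨m, hm⟩ := WithTop.ne_top_iff_exists.1 (cokerDimInt_scalarMatrix_ne_top δ (n := n) hs)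
  refine ⟨cokerDimInt δ B + ((-m : ℤ) : WithTop ℤ), s, hs, B, h, ?_⟩
  rw [← hm, add_assoc, ← WithTop.coe_add]
  simp

/-- The extension of the dimension of the cokernel to `M(n, Q)`: the relative index
of the lattices `Rⁿ` and `Rⁿ A`. -/
noncomputable def latticeIndex (n : ℕ) (A : Matrix (Fin n) (Fin n) (Frac δ)) : WithTop ℤ :=
  (exists_index δ A).choose

/-- Independence of the denominator: by the Ore condition two denominators `s` and `s₀` satisfy `u s
= v s₀` with `u ≠ 0`; then `u B = v B₀`, and the finite value at `u` cancels. -/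
theorem latticeIndex_add {A : Matrix (Fin n) (Fin n) (Frac δ)} {s : SkewPoly δ}
    {B : Matrix (Fin n) (Fin n) (SkewPoly δ)}
    (h : (scalarMatrix δ n s).map (toFrac δ) * A = B.map (toFrac δ)) :
    latticeIndex δ n A + cokerDimInt δ (scalarMatrix δ n s) = cokerDimInt δ B := by
  obtain ⟨s₀, hs₀, B₀, h₀, hz⟩ := (exists_index δ A).choose_spec
  change latticeIndex δ n A + _ = _ at hz
  obtain ⟨u, v, hu, huv⟩ := exists_ore δ s s₀ hs₀
  have hB : scalarMatrix δ n u * B = scalarMatrix δ n v * B₀ := by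
    apply map_toFrac_injective δ
    simp only [Matrix.map_mul]
    rw [← h, ← h₀, ← mul_assoc, ← mul_assoc, ← Matrix.map_mul, ← Matrix.map_mul,
      ← scalarMatrix_mul, ← scalarMatrix_mul, huv]
  have hC := congrArg (cokerDimInt δ) hB
  have hS := congrArg (fun t => cokerDimInt δ (scalarMatrix δ n t)) huv
  simp only [scalarMatrix_mul, cokerDimInt_mul] at hC hS
  refine (WithTop.add_right_inj (cokerDimInt_scalarMatrix_ne_top δ (n := n) hu)).1 ?_
  rw [add_comm (cokerDimInt δ B), hC, ← hz, add_assoc, add_comm (cokerDimInt _ _), hS]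
  abel

theorem latticeIndex_map (A : Matrix (Fin n) (Fin n) (SkewPoly δ)) :
    latticeIndex δ n (A.map (toFrac δ)) = cokerDimInt δ A := by
  have h := latticeIndex_add δ (A := A.map (toFrac δ)) (B := A)
    (by rw [← Matrix.map_mul, scalarMatrix, Matrix.diagonal_one, one_mul])
  rwa [scalarMatrix, Matrix.diagonal_one, cokerDimInt_one, add_zero] at h

theorem latticeIndex_mul (A A' : Matrix (Fin n) (Fin n) (Frac δ)) :
    latticeIndex δ n (A * A') = latticeIndex δ n A + latticeIndex δ n A' := by
  obtain ⟨s, hs, B, h⟩ := exists_common_denominator_matrix δ A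
  obtain ⟨s', hs', B', h'⟩ := exists_common_denominator_matrix δ A'
  -- In `A A' = s⁻¹ B s'⁻¹ B'` the inner denominator must move to the left: writing `B s'⁻¹ = t⁻¹ E`
  -- gives `t s A A' = E B'`.
  obtain ⟨t, ht, E, hE⟩ := exists_common_denominator_matrix δ
    (B.map (toFrac δ) * Matrix.diagonal fun _ => (toFrac δ s')⁻¹)
  have hEs : scalarMatrix δ n t * B = E * scalarMatrix δ n s' := by
    apply map_toFrac_injective δ
    simp only [Matrix.map_mul]
    rw [← hE, mul_assoc, mul_assoc, scalarMatrix, scalarMatrix,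
      Matrix.diagonal_map (map_zero _), Matrix.diagonal_map (map_zero _),
      Matrix.diagonal_mul_diagonal]
    simp [inv_mul_cancel₀ (toFrac_ne_zero δ hs')]
  have hprod : (scalarMatrix δ n (t * s)).map (toFrac δ) * (A * A') = (E * B').map (toFrac δ) := by
    have hEs' := congrArg (fun M => M.map (toFrac δ)) hEs
    simp only [Matrix.map_mul] at hEs'
    rw [scalarMatrix_mul, Matrix.map_mul, Matrix.map_mul, ← h', ← mul_assoc (E.map _), ← hEs', ← h]
    simp only [mul_assoc]
  have e := latticeIndex_add δ hprod
  have e₁ := latticeIndex_add δ h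
  have e₂ := latticeIndex_add δ h'
  have e₃ := congrArg (cokerDimInt δ) hEs
  simp only [scalarMatrix_mul, cokerDimInt_mul] at e e₃
  refine (WithTop.add_right_inj
    (cokerDimInt_scalarMatrix_ne_top δ (n := n) (mul_ne_zero ht hs))).1 ?_
  rw [scalarMatrix_mul, cokerDimInt_mul, e, ← e₂, add_comm (latticeIndex δ n A'), ← add_assoc,
    ← e₃, ← e₁]
  abel

theorem latticeIndex_diagonal (d : Fin n → Frac δ) :
    latticeIndex δ n (Matrix.diagonal d) = ∑ i, degFrac δ (d i) := by
  obtain ⟨s, hs, h⟩ := exists_common_denominator δ d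
  choose r hr using h
  have e := latticeIndex_add δ (A := Matrix.diagonal d) (B := Matrix.diagonal r) (by
    rw [scalarMatrix, Matrix.diagonal_map (map_zero _), Matrix.diagonal_map (map_zero _),
      Matrix.diagonal_mul_diagonal]
    exact congrArg _ (funext hr))
  refine (WithTop.add_right_inj (cokerDimInt_scalarMatrix_ne_top δ (n := n) hs)).1 ?_
  rw [e, scalarMatrix, cokerDimInt_diagonal, cokerDimInt_diagonal, ← Finset.sum_add_distrib]
  refine Finset.sum_congr rfl fun i _ => ?_
  rw [← hr, degFrac_mul, add_comm]

/-- `latticeIndex` satisfies the characterization in `degDetFrac_eq` and restricts to the cokernel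
dimension on matrices over `R`. -/
theorem degDet_eq_cokerDimInt (A : Matrix (Fin n) (Fin n) (SkewPoly δ)) :
    degDet δ A = cokerDimInt δ A := by
  rw [degDet, degDetFrac_eq δ (F := latticeIndex δ) (fun n => latticeIndex_mul δ)
    (fun n => latticeIndex_diagonal δ) (toFrac_ne_zero δ (X_ne_zero δ)), latticeIndex_map]
  rw [← map_one (toFrac δ), ← map_add]
  exact toFrac_ne_zero δ (one_add_X_ne_zero δ)

end Extension

theorem exists_cokerDim_eq (n : ℕ) (hn : 0 < n) (m : ℕ∞) :
    ∃ A : Matrix (Fin n) (Fin n) (SkewPoly δ), cokerDim δ A = m := by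
  obtain ⟨n, rfl⟩ : ∃ l, n = l + 1 := ⟨n - 1, by omega⟩
  suffices H : ∃ r : SkewPoly δ, degFrac δ (toFrac δ r) = natToIntTop m by
    obtain ⟨r, hr⟩ := H
    -- One entry carries the whole value: `r = 0` gives `∞` and `r = xᵐ` gives `m`. A first entry
    -- exists because `n > 0`.
    refine ⟨Matrix.diagonal (Fin.cons r 1), ?_⟩
    have hinj : Function.Injective natToIntTop :=
      WithTop.map_injective Nat.cast_injective
    apply hinj
    rw [natToIntTop_cokerDim_diagonal, Fin.sum_univ_succ, ← hr]
    simp [degFrac_one]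
  induction m using ENat.recTopCoe with
  | top => exact ⟨0, by rw [map_zero, degFrac_zero]; rfl⟩
  | coe m =>
    refine ⟨⟨Polynomial.X ^ m⟩, ?_⟩
    rw [degFrac_toFrac]
    · simp only [natDegree, Polynomial.natDegree_X_pow]
      rfl
    · exact fun h => pow_ne_zero m Polynomial.X_ne_zero (congrArg toPoly h)

/-- The dimension of the cokernel as a homomorphism from `M(n, R)` to `ℕ ∪ {∞}`. -/
noncomputable def cokerDimHom (n : ℕ) :
    Matrix (Fin n) (Fin n) (SkewPoly δ) →* Multiplicative ℕ∞ where
  toFun A := Multiplicative.ofAdd (cokerDim δ A)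
  map_one' := congrArg Multiplicative.ofAdd (cokerDim_one δ)
  map_mul' A B := congrArg Multiplicative.ofAdd (cokerDim_mul δ A B)

end SkewPoly

theorem theorem1 {k : Type u} [Field k] (α : k →+* k) (δ : SkewDerivation α)
    (n : ℕ) (hn : 0 < n) :
    (∃ φ : Matrix (Fin n) (Fin n) (SkewPoly δ) →* Multiplicative ℕ∞,
      (∀ A, SkewPoly.degDet δ A = SkewPoly.natToIntTop (Multiplicative.toAdd (φ A))) ∧
      Function.Injective (Units.coeHom (Matrix (Fin n) (Fin n) (SkewPoly δ))) ∧
      MonoidHom.mrange (Units.coeHom (Matrix (Fin n) (Fin n) (SkewPoly δ))) =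
        MonoidHom.mker φ ∧
      Function.Surjective φ) ∧
    (∀ f : Matrix (Fin n) (Fin n) (SkewPoly δ) → WithTop ℤ,
      (∀ A B, f (A * B) = f A + f B) →
      (∀ d : Fin n → SkewPoly δ,
        f (Matrix.diagonal d) = SkewPoly.degDet δ (Matrix.diagonal d)) →
      ∀ A, f A = SkewPoly.degDet δ A) ∧
    (∀ A : Matrix (Fin n) (Fin n) (SkewPoly δ),
      SkewPoly.degDet δ A = SkewPoly.natToIntTop (SkewPoly.cokerDim δ A)) := by
  refine ⟨⟨SkewPoly.cokerDimHom δ n, SkewPoly.degDet_eq_cokerDimInt δ, Units.val_injective, ?_,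
    fun m => ?_⟩, fun f hmul hdiag A => ?_, SkewPoly.degDet_eq_cokerDimInt δ⟩
  · ext A
    exact (SkewPoly.cokerDim_eq_zero_iff δ A).symm
  · obtain ⟨A, hA⟩ := SkewPoly.exists_cokerDim_eq δ n hn (Multiplicative.toAdd m)
    exact ⟨A, congrArg Multiplicative.ofAdd hA⟩
  · simp only [SkewPoly.degDet_eq_cokerDimInt] at hdiag ⊢
    -- The cokernel dimension plays the first homomorphism, since its value at `1` and its
    -- finiteness on nonsingular diagonals are known; both pass to `f` by agreement on diagonals.
    refine (eq_of_eq_on_diagonal (SkewPoly.elementaryDiagonal_skewPoly δ n)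
      (SkewPoly.cokerDimInt_mul δ) hmul (SkewPoly.cokerDimInt_one δ)
      (SkewPoly.cokerDimInt_diagonal_ne_top δ) (SkewPoly.X_ne_zero δ)
      (SkewPoly.one_add_X_ne_zero δ) (fun d => (hdiag d).symm) A).symm
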